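/- Let $\mathcal H$ be a real Hilbert space with norm $|\cdot|$. For $1<p<\infty$ put $q=p/(p-1)$, $p^*=\max\{p,q\}$ and $$\mathcal D_p=\{(\zeta,\eta,Z,H)\in\mathcal H\times\mathcal H\times[0,\infty)\times[0,\infty): Z\ge|\zeta|^p,\ H\ge|\eta|^q\}.$$ A function $B:\mathcal D_p\to\mathbb R$ satisfies (I) if $$0\le B(\zeta,\eta,Z,H)\le (p^*-1)Z^{1/p}H^{1/q}\quad\text{on }\mathcal D_p,$$ and (II) if for all $a_\pm=(\zeta_\pm,\eta_\pm,Z_\pm,H_\pm)\in\mathcal D_p$ $$B\Big(\frac{a_-+a_+}2\Big)-\frac{B(a_-)+B(a_+)}2\ \ge\ \Big|\frac{\zeta_+-\zeta_-}2\Big|\,\Big|\frac{\eta_+-\eta_-}2\Big|.$$ For $1<p\le 2$ define $\mathcal B_p:\mathcal D_p\to\mathbb R$ as follows. If $|\eta|^qZ\ge|\zeta|^pH$, then $$\mathcal B_p(\zeta,\eta,Z,H)=\frac{(H-|\eta|^q)^{1/q}(Z-|\zeta|^p)^{1/p}}{p-1}.$$ If $|\eta|^qZ<|\zeta|^pH$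 and $Z>|\zeta|^p$, then $$\mathcal B_p(\zeta,\eta,Z,H)=\gamma Z^{1/p}H^{1/q}-|\zeta||\eta|Y,$$ where $(\gamma,Y)$ is the unique pair with $0\le Y<\gamma<(p-1)^{-1}$ and $$\frac{(1-(p-1)Y)(1+Y)^{p-1}}{(1-(p-1)\gamma)(1+\gamma)^{p-1}}=\frac{Z}{|\zeta|^p},\qquad \frac{Y(1+Y)^{p-2}}{\gamma(1+\gamma)^{p-2}}=\Big(\frac{|\eta|^qZ}{|\zeta|^pH}\Big)^{1/q}.$$ If $|\eta|^qZ<|\zeta|^pH$ and $Z=|\zeta|^p$, then $\mathcal B_p(\zeta,\eta,Z,H)=0$. **Theorem.** Let $1<p\le2$. For every $(\zeta,\eta,Z,H)\in\mathcal D_p$ with $|\eta|^qZ<|\zeta|^pH$ and $Z>|\zeta|^p$ the pair $(\gamma,Y)$ above exists and is unique, and $\mathcal B_p$ satisfies (I) and (II). If $p>2$, then the function $(\zeta,\eta,Z,H)\mapsto\mathcal B_q(\eta,\zeta,H,Z)$ satisfies (I) and (II) on $\mathcal D_p$. -/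

import Mathlib

/-- The set of quadruples `(ζ, η, Z, H)` with `Z ≥ |ζ|^p` and `H ≥ |η|^q`, where
`q = Real.conjExponent p = p / (p - 1)`. -/
def ntvDomain (E : Type*) [NormedAddCommGroup E] (p : ℝ) : Set (E × E × ℝ × ℝ) :=
  {a | match a with
    | (ζ, η, Z, H) =>
        0 ≤ Z ∧ 0 ≤ H ∧ ‖ζ‖ ^ p ≤ Z ∧ ‖η‖ ^ Real.conjExponent p ≤ H}

/-- Condition (I): `0 ≤ B ≤ (p* - 1) Z^{1/p} H^{1/q}` on the domain, with `p* = max p (p/(p-1))`.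
(`B` is a total function, but only its values on the domain matter.) -/
def NTVConditionI {E : Type*} [NormedAddCommGroup E] (p : ℝ) (B : E × E × ℝ × ℝ → ℝ) : Prop :=
  ∀ (ζ η : E) (Z H : ℝ), (ζ, η, Z, H) ∈ ntvDomain E p →
    0 ≤ B (ζ, η, Z, H) ∧
    B (ζ, η, Z, H) ≤
      (max p (p / (p - 1)) - 1) * Z ^ (1 / p) * H ^ (1 / Real.conjExponent p)

/-- Condition (II): the midpoint concavity of `B` on the domain with the gap
`|(ζ₊ - ζ₋)/2| |(η₊ - η₋)/2|`. -/
def NTVConditionII {E : Type*} [NormedAddCommGroup E] [NormedSpace ℝ E] (p : ℝ)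
    (B : E × E × ℝ × ℝ → ℝ) : Prop :=
  ∀ (ζ₁ η₁ : E) (Z₁ H₁ : ℝ) (ζ₂ η₂ : E) (Z₂ H₂ : ℝ),
    (ζ₁, η₁, Z₁, H₁) ∈ ntvDomain E p → (ζ₂, η₂, Z₂, H₂) ∈ ntvDomain E p →
    ‖(1 / 2 : ℝ) • (ζ₂ - ζ₁)‖ * ‖(1 / 2 : ℝ) • (η₂ - η₁)‖ ≤
      B ((1 / 2 : ℝ) • (ζ₁ + ζ₂), (1 / 2 : ℝ) • (η₁ + η₂), (Z₁ + Z₂) / 2, (H₁ + H₂) / 2)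
        - (B (ζ₁, η₁, Z₁, H₁) + B (ζ₂, η₂, Z₂, H₂)) / 2

/-- `s = (γ, Y)` lies in the range `0 ≤ Y < γ < 1/(p-1)` and solves the transcendental system
attached to `(ζ, η, Z, H)`. -/
def IsNTVSolution {E : Type*} [NormedAddCommGroup E] (p : ℝ) (ζ η : E) (Z H : ℝ)
    (s : ℝ × ℝ) : Prop :=
  match s with
  | (γ, Y) =>
      0 ≤ Y ∧ Y < γ ∧ γ < (p - 1)⁻¹ ∧
      ((1 - (p - 1) * Y) * (1 + Y) ^ (p - 1)) / ((1 - (p - 1) * γ) * (1 + γ) ^ (p - 1))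
        = Z / ‖ζ‖ ^ p ∧
      (Y * (1 + Y) ^ (p - 2)) / (γ * (1 + γ) ^ (p - 2))
        = ((‖η‖ ^ Real.conjExponent p * Z) / (‖ζ‖ ^ p * H)) ^ (1 / Real.conjExponent p)

/-- A pair `(γ, Y)` solving the system, whenever there is one. -/
noncomputable def ntvSolution {E : Type*} [NormedAddCommGroup E] (p : ℝ) (ζ η : E) (Z H : ℝ) :
    ℝ × ℝ :=
  Classical.epsilon (IsNTVSolution p ζ η Z H)

open Classical in
/-- The explicit function, for `1 < p ≤ 2`. On the boundary part `Z = |ζ|^p` of the second region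
the system has no solution with `Y < γ`, and the function is `0` there. -/
noncomputable def explicitBellman {E : Type*} [NormedAddCommGroup E] (p : ℝ) :
    E × E × ℝ × ℝ → ℝ
  | (ζ, η, Z, H) =>
    let q := Real.conjExponent p
    if ‖η‖ ^ q * Z ≥ ‖ζ‖ ^ p * H then
      (H - ‖η‖ ^ q) ^ (1 / q) * (Z - ‖ζ‖ ^ p) ^ (1 / p) / (p - 1)
    else if Z = ‖ζ‖ ^ p then 0
    else
      (ntvSolution p ζ η Z H).1 * Z ^ (1 / p) * H ^ (1 / q)
        - ‖ζ‖ * ‖η‖ * (ntvSolution p ζ η Z H).2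

/-!
The explicit function is the infimum of a family of functions for which the concavity condition can
be checked one by one, and this infimum is attained in the interior of the domain.

Write `c = (p - 1)⁻¹`, `x = ‖ζ‖`, `e = ‖η‖`, `X = Z ^ (1 / p)`, `K = H ^ (1 / q)`, and let `û` be the
radial Burkholder function (`burkholderFn`). On a level curve `û(X, R) = û(x, r)`, the quantity
`R K - r e` is bounded below by the explicit function. In the region `e ^ q Z ≥ x ^ p H` this is
Hölder's inequality (`exists_curve_le_of_le`). In the other region the two equations for `(γ, Y)`
say that `R = γ X`, `r = Y x` lies on the curve and is a critical point of `R K - r e`. A minimum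
exists by compactness and solves the system (`exists_system_isMin`), and the system has at most one
solution (`system_unique`), so the value at the solution is the minimum.

Adding a Lagrange multiplier for the level curve and bounding the terms in `R`, `X` by powers, with
Young's inequality and `le_burkholderFn`, gives the functions
`κ (û(x, r) + a Z) + b H - r e` (`affineMajorant`). They lie above the explicit function for every
choice of the parameters (`explicitBellman_le_affineMajorant`), and some choice gives equality at a
given interior point (`exists_affineMajorant_eq`).

The gap in the concavity condition comes from the zigzag concavity of Burkholder's function
(`burkholderFn_add_le`): `ζ ↦ û(‖ζ‖, ‖ζ - z‖)` is concave. If `T` is an isometry that turns the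
increment of `η` into the direction of the increment of `ζ`, then `r e` becomes an inner product of
`ζ - z` and `T η`, whose second difference is exactly the product of the norms of the increments
(`exists_affineMajorant_add_le`). Midpoints on the boundary of the domain come, by strict convexity,
from end points with equal `ζ` or equal `η`, where all values are `0`.
-/

/-! ### The level function and its derivative -/

/-- The negative of the radial Burkholder function, `(c - y) (1 + y) ^ (p - 1)` with
`c = (p - 1)⁻¹`. -/
noncomputable def levelFn (p y : ℝ) : ℝ := ((p - 1)⁻¹ - y) * (1 + y) ^ (p - 1)

/-- The function `y (1 + y) ^ (p - 2)`; the derivative of `levelFn p` is `-p` times it. -/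
noncomputable def slopeFn (p y : ℝ) : ℝ := y * (1 + y) ^ (p - 2)

section Scalar

variable {p : ℝ}

theorem one_le_inv_sub_one (hp : 1 < p) (hp2 : p ≤ 2) : 1 ≤ (p - 1)⁻¹ :=
  (one_le_inv₀ (by linarith)).2 (by linarith)

theorem slopeFn_zero : slopeFn p 0 = 0 := by simp [slopeFn]

theorem slopeFn_pos {y : ℝ} (hy : 0 < y) : 0 < slopeFn p y :=
  mul_pos hy (Real.rpow_pos_of_pos (by linarith) _)

theorem slopeFn_nonneg {y : ℝ} (hy : 0 ≤ y) : 0 ≤ slopeFn p y :=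
  mul_nonneg hy (Real.rpow_nonneg (by linarith) _)

theorem continuousAt_slopeFn {y : ℝ} (hy : 0 ≤ y) : ContinuousAt (slopeFn p) y := by
  unfold slopeFn
  have : ContinuousAt (fun y : ℝ => (1 + y) ^ (p - 2)) y :=
    ContinuousAt.rpow_const (by fun_prop) (Or.inl (by linarith))
  fun_prop

theorem slopeFn_mono (hp : 1 < p) {a b : ℝ} (ha : 0 ≤ a) (hab : a ≤ b) :
    slopeFn p a ≤ slopeFn p b := by
  have key : ∀ y : ℝ, 0 ≤ y → slopeFn p y = y / (1 + y) * (1 + y) ^ (p - 1) := by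
    intro y hy
    have : (1 + y) ^ (p - 1) = (1 + y) ^ (p - 2) * (1 + y) := by
      rw [← Real.rpow_add_one (by linarith)]; ring_nf
    rw [slopeFn, this]
    field_simp
  rw [key a ha, key b (ha.trans hab)]
  have h1 : a / (1 + a) ≤ b / (1 + b) := by
    rw [div_le_div_iff₀ (by linarith) (by linarith)]
    nlinarith
  have h2 : (1 + a) ^ (p - 1) ≤ (1 + b) ^ (p - 1) :=
    Real.rpow_le_rpow (by linarith) (by linarith) (by linarith)
  exact mul_le_mul h1 h2 (Real.rpow_nonneg (by linarith) _)
    (div_nonneg (by linarith) (by linarith))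

theorem hasDerivAt_levelFn (hp : 1 < p) {y : ℝ} (hy : 0 ≤ y) :
    HasDerivAt (levelFn p) (-(p * slopeFn p y)) y := by
  have h1 : HasDerivAt (fun y : ℝ => (1 + y) ^ (p - 1))
      (1 * (p - 1) * (1 + y) ^ (p - 1 - 1)) y :=
    ((hasDerivAt_id y).const_add 1).rpow_const (Or.inl (by simp; linarith))
  have h2 := ((hasDerivAt_id y).const_sub (p - 1)⁻¹).mul h1
  refine h2.congr_deriv ?_
  have e1 : (1 + y) ^ (p - 1) = (1 + y) ^ (p - 2) * (1 + y) := by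
    rw [← Real.rpow_add_one (by linarith)]; ring_nf
  have e2 : p - 1 - 1 = p - 2 := by ring
  have h : p - 1 ≠ 0 := by linarith
  rw [e2, e1, slopeFn, id]
  field_simp
  ring

theorem continuous_levelFn (hp : 1 < p) : Continuous (levelFn p) := by
  unfold levelFn
  have : Continuous fun y : ℝ => (1 + y) ^ (p - 1) :=
    Continuous.rpow_const (by fun_prop) fun _ => Or.inr (by linarith)
  fun_prop

theorem levelFn_inv (p : ℝ) : levelFn p (p - 1)⁻¹ = 0 := by simp [levelFn]

theorem levelFn_zero (p : ℝ) : levelFn p 0 = (p - 1)⁻¹ := by simp [levelFn]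

theorem levelFn_pos {y : ℝ} (hy : 0 ≤ y) (hyc : y < (p - 1)⁻¹) : 0 < levelFn p y :=
  mul_pos (by linarith) (Real.rpow_pos_of_pos (by linarith) _)

theorem exists_levelFn_sub (hp : 1 < p) {a b : ℝ} (ha : 0 ≤ a) (hab : a < b) :
    ∃ ξ ∈ Set.Ioo a b, levelFn p a - levelFn p b = p * slopeFn p ξ * (b - a) := by
  obtain ⟨ξ, hξ, h⟩ := exists_hasDerivAt_eq_slope (levelFn p) (fun y => -(p * slopeFn p y)) hab
    (continuous_levelFn hp).continuousOn
    fun y hy => hasDerivAt_levelFn hp (ha.trans hy.1.le)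
  refine ⟨ξ, hξ, ?_⟩
  have : b - a ≠ 0 := by linarith
  have h : -(p * slopeFn p ξ) = (levelFn p b - levelFn p a) / (b - a) := h
  field_simp at h
  linarith

theorem levelFn_sub_le (hp : 1 < p) {a b : ℝ} (ha : 0 ≤ a) (hab : a ≤ b) :
    levelFn p a - levelFn p b ≤ p * slopeFn p b * (b - a) := by
  rcases hab.eq_or_lt with rfl | hab
  · simp
  obtain ⟨ξ, hξ, h⟩ := exists_levelFn_sub hp ha hab
  rw [h]
  have := slopeFn_mono hp (ha.trans hξ.1.le) hξ.2.le
  gcongr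

theorem le_levelFn_sub (hp : 1 < p) {a b : ℝ} (ha : 0 ≤ a) (hab : a ≤ b) :
    p * slopeFn p a * (b - a) ≤ levelFn p a - levelFn p b := by
  rcases hab.eq_or_lt with rfl | hab
  · simp
  obtain ⟨ξ, hξ, h⟩ := exists_levelFn_sub hp ha hab
  rw [h]
  have := slopeFn_mono hp ha hξ.1.le
  gcongr

theorem levelFn_lt (hp : 1 < p) {a b : ℝ} (ha : 0 ≤ a) (hab : a < b) :
    levelFn p b < levelFn p a := by
  obtain ⟨ξ, hξ, h⟩ := exists_levelFn_sub hp ha hab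
  have := slopeFn_pos (p := p) (ha.trans_lt hξ.1)
  have : 0 < p * slopeFn p ξ * (b - a) := by
    have : 0 < b - a := by linarith
    positivity
  linarith

theorem le_of_levelFn_le (hp : 1 < p) {a b : ℝ} (ha : 0 ≤ a)
    (h : levelFn p a ≤ levelFn p b) : b ≤ a := by
  by_contra! hlt
  exact absurd h (not_le.2 (levelFn_lt hp ha hlt))

theorem eq_of_levelFn_eq (hp : 1 < p) {a b : ℝ} (ha : 0 ≤ a) (hb : 0 ≤ b)
    (h : levelFn p a = levelFn p b) : a = b :=
  le_antisymm (le_of_levelFn_le hp hb h.ge) (le_of_levelFn_le hp ha h.le)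

/-- Every value in `[0, c]` is attained by `levelFn p` on `[0, c]`. -/
theorem exists_levelFn_eq (hp : 1 < p) {v : ℝ} (hv : 0 ≤ v) (hvc : v ≤ (p - 1)⁻¹) :
    ∃ y, 0 ≤ y ∧ y ≤ (p - 1)⁻¹ ∧ levelFn p y = v := by
  have hc : 0 ≤ (p - 1)⁻¹ := inv_nonneg.2 (by linarith)
  have := intermediate_value_Icc' hc (continuous_levelFn hp).continuousOn
  rw [levelFn_inv, levelFn_zero] at this
  obtain ⟨y, hy, h⟩ := this ⟨hv, hvc⟩
  exact ⟨y, hy.1, hy.2, h⟩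

end Scalar

/-! ### Uniqueness and minimality for the transcendental system -/

section Scalar

variable {p : ℝ}

/-- If `log (levelFn p)` changes by the same amount over two successive intervals `[a, b]` and
`[a', b']`, then `log (slopeFn p)` changes more over the first one. The reason is that
`-(log (levelFn p))' / (log (slopeFn p))' = p y² / ((c - y) (1 + (p - 1) y))` is increasing. -/
theorem slopeFn_mul_lt (hp : 1 < p) {a b a' b' : ℝ} (ha : 0 < a) (hab : a < b) (hba : b ≤ a')
    (hab' : a' < b') (hb' : b' < (p - 1)⁻¹)
    (h : levelFn p a * levelFn p b' = levelFn p b * levelFn p a') :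
    slopeFn p a * slopeFn p b' < slopeFn p b * slopeFn p a' := by
  set c := (p - 1)⁻¹ with hc
  have hp1 : 0 < p - 1 := by linarith
  set k : ℝ → ℝ := fun y => p * y ^ 2 / ((c - y) * (1 + (p - 1) * y)) with hk
  have hkpos : 0 < k b := by
    have : 0 < c - b := by linarith
    have : 0 < b := by linarith
    simp only [hk]
    positivity
  have hkmono : ∀ y z, 0 < y → y < z → z < c → k y < k z := by
    intro y z hy hyz hz
    have h1 : 0 < c - y := by linarith
    have h2 : 0 < c - z := by linarith
    have hz0 : 0 < z := by linarith
    have e : ∀ y, k y = p * (y / (c - y) * (y / (1 + (p - 1) * y))) := by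
      intro y; simp only [hk]; rw [div_mul_div_comm, mul_div_assoc, sq]
    rw [e, e]
    refine mul_lt_mul_of_pos_left ?_ (by linarith)
    have i1 : y / (c - y) < z / (c - z) := by
      rw [div_lt_div_iff₀ h1 h2]; nlinarith
    have i2 : y / (1 + (p - 1) * y) ≤ z / (1 + (p - 1) * z) := by
      rw [div_le_div_iff₀ (by positivity) (by positivity)]; nlinarith
    exact mul_lt_mul i1 i2 (by positivity) (by positivity)
  set G : ℝ → ℝ := fun y => Real.log (levelFn p y) + k b * Real.log (slopeFn p y) with hG
  have hGd : ∀ y, 0 < y → y < c →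
      HasDerivAt G ((1 + (p - 1) * y) / (y * (1 + y)) * (k b - k y)) y := by
    intro y hy hyc
    have h1 : 0 < c - y := by linarith
    have h2 : 0 < 1 + y := by linarith
    have d1 : HasDerivAt (fun y : ℝ => 1 + y) 1 y := (hasDerivAt_id y).const_add 1
    have dN := (hasDerivAt_levelFn hp hy.le).log (levelFn_pos hy.le hyc).ne'
    have dψ0 := (hasDerivAt_id y).mul (d1.rpow_const (p := p - 2) (Or.inl h2.ne'))
    have dψ : HasDerivAt (slopeFn p) _ y := dψ0
    have dL := dψ.log (slopeFn_pos hy).ne'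
    refine (dN.add (dL.const_mul (k b))).congr_deriv ?_
    have e1 : (1 + y) ^ (p - 1) = (1 + y) ^ (p - 2) * (1 + y) := by
      rw [← Real.rpow_add_one h2.ne']; ring_nf
    have e2 : (1 + y) ^ (p - 2) = (1 + y) ^ (p - 2 - 1) * (1 + y) := by
      rw [← Real.rpow_add_one h2.ne']; ring_nf
    have hw : 0 < (1 + y) ^ (p - 2 - 1) := Real.rpow_pos_of_pos h2 _
    generalize hkb : k b = K
    simp only [hk, levelFn, slopeFn, id]
    rw [← hc, e1, e2]
    generalize (1 + y) ^ (p - 2 - 1) = w at *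
    have h3 : 0 < 1 + (p - 1) * y := by positivity
    field_simp
    ring
  have m1 : G a < G b := by
    have : StrictMonoOn G (Set.Icc a b) := by
      refine strictMonoOn_of_deriv_pos (convex_Icc a b) ?_ ?_
      · intro y hy
        exact (hGd y (by linarith [hy.1]) (by linarith [hy.2])).continuousAt.continuousWithinAt
      · intro y hy
        rw [interior_Icc] at hy
        have hy0 : 0 < y := ha.trans hy.1
        rw [(hGd y hy0 (by linarith [hy.2])).deriv]
        have := hkmono y b hy0 hy.2 (by linarith)
        have : 0 < k b - k y := by linarith
        positivity
    exact this (Set.left_mem_Icc.2 hab.le) (Set.right_mem_Icc.2 hab.le) hab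
  have m2 : G b' < G a' := by
    have : StrictAntiOn G (Set.Icc a' b') := by
      refine strictAntiOn_of_deriv_neg (convex_Icc a' b') ?_ ?_
      · intro y hy
        exact (hGd y (by linarith [hy.1]) (by linarith [hy.2])).continuousAt.continuousWithinAt
      · intro y hy
        rw [interior_Icc] at hy
        have hy0 : 0 < y := by linarith [hy.1]
        rw [(hGd y hy0 (by linarith [hy.2])).deriv]
        have := hkmono b y (by linarith) (by linarith [hy.1]) (by linarith [hy.2])
        have : k b - k y < 0 := by linarith
        exact mul_neg_of_pos_of_neg (by positivity) this
    exact this (Set.left_mem_Icc.2 hab'.le) (Set.right_mem_Icc.2 hab'.le) hab'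
  have hN : ∀ y, 0 < y → y < c → 0 < levelFn p y := fun y h1 h2 => levelFn_pos h1.le h2
  have Na := hN a ha (by linarith)
  have Nb := hN b (by linarith) (by linarith)
  have Na' := hN a' (by linarith) (by linarith)
  have Nb' := hN b' (by linarith) (by linarith)
  have Sa := slopeFn_pos (p := p) ha
  have Sb := slopeFn_pos (p := p) (y := b) (by linarith)
  have Sa' := slopeFn_pos (p := p) (y := a') (by linarith)
  have Sb' := slopeFn_pos (p := p) (y := b') (by linarith)
  have hlog := congrArg Real.log h
  rw [Real.log_mul Na.ne' Nb'.ne', Real.log_mul Nb.ne' Na'.ne'] at hlog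
  rw [← Real.log_lt_log_iff (mul_pos Sa Sb') (mul_pos Sb Sa'), Real.log_mul Sa.ne' Sb'.ne',
    Real.log_mul Sb.ne' Sa'.ne']
  simp only [hG] at m1 m2
  have : 0 < k b * (Real.log (slopeFn p b) + Real.log (slopeFn p a')
      - (Real.log (slopeFn p a) + Real.log (slopeFn p b'))) := by
    nlinarith
  have := (mul_pos_iff_of_pos_left hkpos).1 this
  linarith

/-- Monotonicity behind the uniqueness of solutions: of the intervals `[Y₁, Y₂]`, `[γ₁, γ₂]` or of
`[Y₁, γ₁]`, `[Y₂, γ₂]` one pair does not overlap, and `slopeFn_mul_lt` applies to it. -/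
theorem not_lt_of_system (hp : 1 < p) {M θ Y₁ γ₁ Y₂ γ₂ : ℝ} (hM : 1 < M)
    (h1 : 0 ≤ Y₁) (h1' : Y₁ < γ₁) (h2 : 0 ≤ Y₂) (h2' : Y₂ < γ₂)
    (h2c : γ₂ < (p - 1)⁻¹)
    (hN1 : levelFn p Y₁ = M * levelFn p γ₁) (hN2 : levelFn p Y₂ = M * levelFn p γ₂)
    (hS1 : slopeFn p Y₁ = θ * slopeFn p γ₁) (hS2 : slopeFn p Y₂ = θ * slopeFn p γ₂) :
    ¬ Y₁ < Y₂ := by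
  intro hlt
  have hY2 : 0 < Y₂ := h1.trans_lt hlt
  have hθ : 0 < θ := by
    have a := slopeFn_pos (p := p) hY2
    have b := slopeFn_pos (p := p) (hY2.trans h2')
    rw [hS2] at a
    exact (pos_iff_pos_of_mul_pos a).2 b
  have hY1 : 0 < Y₁ := by
    rcases h1.eq_or_lt with rfl | h
    · have b := mul_pos hθ (slopeFn_pos (p := p) h1')
      rw [← hS1, slopeFn_zero] at b
      exact absurd b (lt_irrefl _)
    · exact h
  have hγ : γ₁ < γ₂ := by
    by_contra! hle
    have := levelFn_lt hp h1 hlt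
    rw [hN1, hN2] at this
    have h3 : levelFn p γ₂ < levelFn p γ₁ := lt_of_mul_lt_mul_left this (by linarith)
    rcases hle.eq_or_lt with h | h
    · rw [h] at h3; exact absurd h3 (lt_irrefl _)
    · exact absurd (levelFn_lt hp (h2.trans h2'.le) h) (not_lt.2 h3.le)
  rcases le_or_gt Y₂ γ₁ with hle | hgt
  · have := slopeFn_mul_lt hp hY1 hlt hle hγ h2c (by rw [hN1, hN2]; ring)
    rw [hS1, hS2] at this
    linarith
  · have := slopeFn_mul_lt hp hY1 h1' hgt.le h2' h2c (by rw [hN1, hN2]; ring)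
    rw [hS1, hS2] at this
    linarith

theorem system_unique (hp : 1 < p) {M θ Y₁ γ₁ Y₂ γ₂ : ℝ} (hM : 1 < M)
    (h1 : 0 ≤ Y₁) (h1' : Y₁ < γ₁) (h1c : γ₁ < (p - 1)⁻¹) (h2 : 0 ≤ Y₂) (h2' : Y₂ < γ₂)
    (h2c : γ₂ < (p - 1)⁻¹)
    (hN1 : levelFn p Y₁ = M * levelFn p γ₁) (hN2 : levelFn p Y₂ = M * levelFn p γ₂)
    (hS1 : slopeFn p Y₁ = θ * slopeFn p γ₁) (hS2 : slopeFn p Y₂ = θ * slopeFn p γ₂) :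
    Y₁ = Y₂ ∧ γ₁ = γ₂ := by
  have hY : Y₁ = Y₂ := le_antisymm
    (not_lt.1 (not_lt_of_system hp hM h2 h2' h1 h1' h1c hN2 hN1 hS2 hS1))
    (not_lt.1 (not_lt_of_system hp hM h1 h1' h2 h2' h2c hN1 hN2 hS1 hS2))
  refine ⟨hY, eq_of_levelFn_eq hp (h1.trans h1'.le) (h2.trans h2'.le) ?_⟩
  rw [hY, hN2] at hN1
  exact (mul_left_cancel₀ (by linarith) hN1).symm

/-- The linear function `M γ - θ Y` attains its minimum on the curve
`levelFn p Y = M * levelFn p γ` in `[0, c]²` at a solution of the system: the second equation is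
the first-order condition for the minimum. -/
theorem exists_system_isMin (hp : 1 < p) {M θ : ℝ} (hM : 1 < M) (hθ : 0 ≤ θ) (hθ1 : θ < 1) :
    ∃ Y γ, 0 ≤ Y ∧ Y < γ ∧ γ < (p - 1)⁻¹ ∧ levelFn p Y = M * levelFn p γ ∧
      slopeFn p Y = θ * slopeFn p γ ∧
      ∀ Y' γ', 0 ≤ Y' → Y' ≤ (p - 1)⁻¹ → 0 ≤ γ' → γ' ≤ (p - 1)⁻¹ →
        levelFn p Y' = M * levelFn p γ' → M * γ - θ * Y ≤ M * γ' - θ * Y' := by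
  set c := (p - 1)⁻¹ with hc
  have hc0 : 0 < c := inv_pos.2 (by linarith)
  have hM0 : 0 < M := by linarith
  set K : Set (ℝ × ℝ) := (Set.Icc 0 c ×ˢ Set.Icc 0 c) ∩
    {z | levelFn p z.1 = M * levelFn p z.2} with hK
  have hN := continuous_levelFn hp
  have hKc : IsCompact K := by
    refine (isCompact_Icc.prod isCompact_Icc).inter_right (isClosed_eq ?_ ?_) <;> fun_prop
  have hKne : K.Nonempty := ⟨(c, c), ⟨⟨⟨hc0.le, le_rfl⟩, ⟨hc0.le, le_rfl⟩⟩, by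
    simp [hc, levelFn_inv]⟩⟩
  obtain ⟨⟨Y, γ⟩, ⟨⟨⟨hY0, hYc⟩, ⟨hγ0, hγc⟩⟩, hNe⟩, hmin⟩ :=
    hKc.exists_isMinOn hKne (f := fun z => M * z.2 - θ * z.1) (by fun_prop)
  simp only [Set.mem_ofPred_eq] at hY0 hYc hγ0 hγc hNe
  have hmin' : ∀ Y' γ', 0 ≤ Y' → Y' ≤ c → 0 ≤ γ' → γ' ≤ c →
      levelFn p Y' = M * levelFn p γ' → M * γ - θ * Y ≤ M * γ' - θ * Y' :=
    fun Y' γ' h1 h2 h3 h4 h5 => hmin (a := (Y', γ')) ⟨⟨⟨h1, h2⟩, ⟨h3, h4⟩⟩, h5⟩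
  -- the curve is a graph over `[0, c]`
  have hex : ∀ Y', 0 ≤ Y' → Y' ≤ c → ∃ γ', 0 ≤ γ' ∧ γ' ≤ c ∧
      levelFn p Y' = M * levelFn p γ' := by
    intro Y' h1 h2
    have h3 : 0 ≤ levelFn p Y' := by
      rcases h2.eq_or_lt with rfl | h
      · rw [hc, levelFn_inv]
      · exact (levelFn_pos h1 h).le
    have h4 : levelFn p Y' ≤ c := by
      have := le_levelFn_sub hp le_rfl h1
      rw [slopeFn_zero, levelFn_zero] at this
      linarith
    obtain ⟨γ', h5, h6, h7⟩ := exists_levelFn_eq hp (v := levelFn p Y' / M) (by positivity)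
      ((div_le_self h3 hM.le).trans h4)
    exact ⟨γ', h5, h6, by rw [h7]; field_simp⟩
  have hp0 : 0 < p := by linarith
  -- one-sided first-order conditions
  have up : ∀ Y', Y < Y' → Y' ≤ c → θ * slopeFn p γ ≤ slopeFn p Y' := by
    intro Y' h1 h2
    obtain ⟨γ', h3, h4, h5⟩ := hex Y' (hY0.trans h1.le) h2
    have hle : γ ≤ γ' := by
      refine le_of_levelFn_le hp h3 (le_of_mul_le_mul_left ?_ hM0)
      rw [← h5, ← hNe]
      exact (levelFn_lt hp hY0 h1).le
    have a1 := le_levelFn_sub hp hγ0 hle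
    have a2 := levelFn_sub_le hp hY0 h1.le
    have a3 := hmin' Y' γ' (hY0.trans h1.le) h2 h3 h4 h5
    have a4 := slopeFn_nonneg (p := p) hγ0
    have a5 : slopeFn p γ * (θ * (Y' - Y)) ≤ slopeFn p γ * (M * (γ' - γ)) :=
      mul_le_mul_of_nonneg_left (by linarith) a4
    rw [hNe, h5] at a2
    have a6 : p * slopeFn p γ * (γ' - γ) * M ≤ (levelFn p γ - levelFn p γ') * M :=
      mul_le_mul_of_nonneg_right a1 hM0.le
    have a7 : p * ((Y' - Y) * (θ * slopeFn p γ)) ≤ p * ((Y' - Y) * slopeFn p Y') := by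
      nlinarith
    exact le_of_mul_le_mul_left (le_of_mul_le_mul_left a7 hp0) (by linarith)
  have down : ∀ Y', 0 ≤ Y' → Y' < Y → slopeFn p Y' ≤ θ * slopeFn p γ := by
    intro Y' h1 h2
    obtain ⟨γ', h3, h4, h5⟩ := hex Y' h1 (h2.le.trans hYc)
    have hle : γ' ≤ γ := by
      refine le_of_levelFn_le hp hγ0 (le_of_mul_le_mul_left ?_ hM0)
      rw [← h5, ← hNe]
      exact (levelFn_lt hp h1 h2).le
    have a1 := levelFn_sub_le hp h3 hle
    have a2 := le_levelFn_sub hp h1 h2.le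
    have a3 := hmin' Y' γ' h1 (h2.le.trans hYc) h3 h4 h5
    have a4 := slopeFn_nonneg (p := p) hγ0
    have a5 : slopeFn p γ * (M * (γ - γ')) ≤ slopeFn p γ * (θ * (Y - Y')) :=
      mul_le_mul_of_nonneg_left (by linarith) a4
    rw [hNe, h5] at a2
    have a6 : (levelFn p γ' - levelFn p γ) * M ≤ p * slopeFn p γ * (γ - γ') * M :=
      mul_le_mul_of_nonneg_right a1 hM0.le
    have a7 : p * ((Y - Y') * slopeFn p Y') ≤ p * ((Y - Y') * (θ * slopeFn p γ)) := by
      nlinarith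
    exact le_of_mul_le_mul_left (le_of_mul_le_mul_left a7 hp0) (by linarith)
  have hge : Y < c → θ * slopeFn p γ ≤ slopeFn p Y := by
    intro h
    refine ge_of_tendsto ((continuousAt_slopeFn (p := p) hY0).tendsto.mono_left
      (nhdsWithin_le_nhds (s := Set.Ioi Y))) ?_
    filter_upwards [Ioc_mem_nhdsGT h] with Y' hY' using up Y' hY'.1 hY'.2
  have hle : 0 < Y → slopeFn p Y ≤ θ * slopeFn p γ := by
    intro h
    refine le_of_tendsto ((continuousAt_slopeFn (p := p) hY0).tendsto.mono_left
      (nhdsWithin_le_nhds (s := Set.Iio Y))) ?_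
    filter_upwards [Ico_mem_nhdsLT h] with Y' hY' using down Y' hY'.1 hY'.2
  have hYlt : Y < c := by
    refine lt_of_le_of_ne hYc fun h => ?_
    have h1 := hle (h ▸ hc0)
    have h2 : γ ≤ Y := h ▸ hγc
    have h3 := slopeFn_mono hp hγ0 h2
    have h4 := slopeFn_pos (p := p) (y := Y) (h ▸ hc0)
    nlinarith [slopeFn_nonneg (p := p) hγ0]
  have hNY := levelFn_pos hY0 hYlt
  have hNγ : 0 < levelFn p γ := by
    rw [hNe] at hNY
    exact (mul_pos_iff_of_pos_left hM0).1 hNY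
  have hγlt : γ < c := by
    refine lt_of_le_of_ne hγc fun h => ?_
    rw [h, hc, levelFn_inv] at hNγ
    exact lt_irrefl _ hNγ
  have hYγ : Y < γ := by
    by_contra! h
    have := le_levelFn_sub hp hγ0 h
    have h2 : 0 ≤ p * slopeFn p γ * (Y - γ) := by
      have := slopeFn_nonneg (p := p) hγ0
      have : 0 ≤ Y - γ := by linarith
      positivity
    nlinarith
  refine ⟨Y, γ, hY0, hYγ, hγlt, hNe, le_antisymm ?_ (hge hYlt), hmin'⟩
  rcases hY0.eq_or_lt with h | h
  · rw [← h, slopeFn_zero]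
    exact mul_nonneg hθ (slopeFn_nonneg hγ0)
  · exact hle h

end Scalar

/-! ### Burkholder's function and its zigzag concavity -/

/-- The radial profile `û(x, r)` of Burkholder's function for `1 < p ≤ 2`: with `c = (p - 1)⁻¹`
it is `(r - c x) (x + r) ^ (p - 1)` for `r ≤ c x`, and a multiple of `r ^ p - (c x) ^ p` beyond. -/
noncomputable def burkholderFn (p x r : ℝ) : ℝ :=
  if r ≤ (p - 1)⁻¹ * x then (r - (p - 1)⁻¹ * x) * (x + r) ^ (p - 1)
  else p ^ (p - 2) * (r ^ p - ((p - 1)⁻¹ * x) ^ p)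

section Scalar

variable {p : ℝ}

theorem continuous_burkholderFn (hp : 1 < p) :
    Continuous fun z : ℝ × ℝ => burkholderFn p z.1 z.2 := by
  unfold burkholderFn
  refine Continuous.if_le ?_ ?_ (by fun_prop) (by fun_prop) ?_
  · have : Continuous fun z : ℝ × ℝ => (z.1 + z.2) ^ (p - 1) :=
      Continuous.rpow_const (by fun_prop) fun _ => Or.inr (by linarith)
    fun_prop
  · have h1 : Continuous fun z : ℝ × ℝ => z.2 ^ p :=
      Continuous.rpow_const (by fun_prop) fun _ => Or.inr (by linarith)
    have h2 : Continuous fun z : ℝ × ℝ => ((p - 1)⁻¹ * z.1) ^ p :=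
      Continuous.rpow_const (by fun_prop) fun _ => Or.inr (by linarith)
    fun_prop
  · intro z hz
    simp [hz]

/-- Concavity of two functions glued along `g = 0` with matching values and derivatives. The
derivative of `f₂` has to decrease only where `f₂` is used. -/
theorem concaveOn_of_piecewise {f f₁ f₂ d₁ d₂ g : ℝ → ℝ}
    (hf : ∀ s, f s = if g s ≤ 0 then f₁ s else f₂ s)
    (hd₁ : ∀ s, HasDerivAt f₁ (d₁ s) s) (hd₂ : ∀ s, HasDerivAt f₂ (d₂ s) s)
    (hg : Continuous g) (h0 : ∀ s, g s = 0 → f₁ s = f₂ s ∧ d₁ s = d₂ s)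
    (ha₁ : Antitone d₁) (ha₂ : AntitoneOn d₂ {s | 0 ≤ g s}) : ConcaveOn ℝ Set.univ f := by
  set d : ℝ → ℝ := fun s => if g s ≤ 0 then d₁ s else d₂ s with hd
  have hfd : ∀ s, HasDerivAt f (d s) s := by
    intro s
    rcases lt_trichotomy (g s) 0 with h | h | h
    · have : f =ᶠ[nhds s] f₁ := by
        filter_upwards [hg.continuousAt.eventually_lt continuousAt_const h] with t ht
        rw [hf, if_pos ht.le]
      simp only [hd, if_pos h.le]
      exact (hd₁ s).congr_of_eventuallyEq this
    · have hU : {t | g t ≤ 0} ∪ {t | 0 ≤ g t} = Set.univ := by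
        ext t; simpa using le_total (g t) 0
      rw [← hasDerivWithinAt_univ, ← hU]
      refine HasDerivWithinAt.union ?_ ?_
      · simp only [hd, if_pos h.le]
        exact (hd₁ s).hasDerivWithinAt.congr (fun t ht => by rw [hf, if_pos (show g t ≤ 0 from ht)])
          (by rw [hf, if_pos h.le])
      · simp only [hd, if_pos h.le]
        rw [(h0 s h).2]
        refine (hd₂ s).hasDerivWithinAt.congr (fun t ht => ?_) ?_
        · rw [hf]
          split_ifs with h'
          · exact (h0 t (le_antisymm h' ht)).1
          · rfl
        · rw [hf, if_pos h.le, (h0 s h).1]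
    · have : f =ᶠ[nhds s] f₂ := by
        filter_upwards [continuousAt_const.eventually_lt hg.continuousAt h] with t ht
        rw [hf, if_neg (not_le.2 ht)]
      simp only [hd, if_neg (not_le.2 h)]
      exact (hd₂ s).congr_of_eventuallyEq this
  have hda : Antitone d := by
    intro s t hst
    by_cases h1 : g s ≤ 0
    · by_cases h2 : g t ≤ 0
      · simp only [hd, if_pos h1, if_pos h2]; exact ha₁ hst
      · obtain ⟨u, hu, hu0⟩ := intermediate_value_Icc hst hg.continuousOn
          ⟨h1, (not_le.1 h2).le⟩
        simp only [hd, if_pos h1, if_neg h2]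
        calc d₂ t ≤ d₂ u := ha₂ hu0.ge (not_le.1 h2).le hu.2
          _ = d₁ u := (h0 u hu0).2.symm
          _ ≤ d₁ s := ha₁ hu.1
    · by_cases h2 : g t ≤ 0
      · obtain ⟨u, hu, hu0⟩ := intermediate_value_Icc' hst hg.continuousOn
          ⟨h2, (not_le.1 h1).le⟩
        simp only [hd, if_neg h1, if_pos h2]
        calc d₁ t ≤ d₁ u := ha₁ hu.2
          _ = d₂ u := (h0 u hu0).2
          _ ≤ d₂ s := ha₂ (not_le.1 h1).le hu0.ge hu.1
      · simp only [hd, if_neg h1, if_neg h2]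
        exact ha₂ (not_le.1 h1).le (not_le.1 h2).le hst
  have hderiv : deriv f = d := funext fun s => (hfd s).deriv
  exact Antitone.concaveOn_univ_of_deriv (fun s => (hfd s).differentiableAt) (hderiv ▸ hda)

theorem hasDerivAt_sqrt_sq_add {α A : ℝ} (hA : 0 < A) (s : ℝ) :
    HasDerivAt (fun s => √((s + α) ^ 2 + A)) ((s + α) / √((s + α) ^ 2 + A)) s := by
  have h1 : HasDerivAt (fun s : ℝ => (s + α) ^ 2 + A) (2 * (s + α)) s := by
    have := (((hasDerivAt_id s).add_const α).pow 2).add_const A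
    simpa using this
  refine (h1.sqrt (by positivity)).congr_deriv ?_
  rw [mul_div_mul_left _ _ two_ne_zero]

theorem hasDerivAt_div_sqrt_sq_add {α A : ℝ} (hA : 0 < A) (s : ℝ) :
    HasDerivAt (fun s => (s + α) / √((s + α) ^ 2 + A))
      ((1 - ((s + α) / √((s + α) ^ 2 + A)) ^ 2) / √((s + α) ^ 2 + A)) s := by
  have hX : 0 < √((s + α) ^ 2 + A) := by positivity
  refine (((hasDerivAt_id s).add_const α).div (hasDerivAt_sqrt_sq_add hA s)
    hX.ne').congr_deriv ?_
  simp only [id]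
  generalize √((s + α) ^ 2 + A) = X at *
  field_simp

theorem div_sqrt_sq_add_sq_le {α A : ℝ} (hA : 0 < A) (s : ℝ) :
    ((s + α) / √((s + α) ^ 2 + A)) ^ 2 ≤ 1 := by
  rw [div_pow, Real.sq_sqrt (by positivity)]
  exact div_le_one_of_le₀ (by linarith) (by positivity)

/-- Concavity of the profile along a line in direction `(1, 1)` that avoids the singularities:
`√((s + α) ^ 2 + A)` and `√((s + β) ^ 2 + B)` are the distances of a point moving with unit
speed from two fixed points off its path. -/
theorem concaveOn_burkholderFn_line (hp : 1 < p) (hp2 : p ≤ 2) {α A β B : ℝ} (hA : 0 < A)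
    (hB : 0 < B) :
    ConcaveOn ℝ Set.univ fun s =>
      burkholderFn p (√((s + α) ^ 2 + A)) (√((s + β) ^ 2 + B)) := by
  have hp0 : 0 < p := by linarith
  have hp1 : 0 < p - 1 := by linarith
  set c := (p - 1)⁻¹ with hc
  have hc1 : 1 ≤ c := one_le_inv_sub_one hp hp2
  have hcp : c * (p - 1) = 1 := inv_mul_cancel₀ hp1.ne'
  set X : ℝ → ℝ := fun s => √((s + α) ^ 2 + A) with hX
  set R : ℝ → ℝ := fun s => √((s + β) ^ 2 + B) with hR
  set m : ℝ → ℝ := fun s => (s + α) / X s with hm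
  set n : ℝ → ℝ := fun s => (s + β) / R s with hn
  have X0 : ∀ s, 0 < X s := fun s => Real.sqrt_pos.2 (by positivity)
  have R0 : ∀ s, 0 < R s := fun s => Real.sqrt_pos.2 (by positivity)
  have dX : ∀ s, HasDerivAt X (m s) s := fun s => hasDerivAt_sqrt_sq_add hA s
  have dR : ∀ s, HasDerivAt R (n s) s := fun s => hasDerivAt_sqrt_sq_add hB s
  have dm : ∀ s, HasDerivAt m ((1 - m s ^ 2) / X s) s :=
    fun s => hasDerivAt_div_sqrt_sq_add hA s
  have dn : ∀ s, HasDerivAt n ((1 - n s ^ 2) / R s) s :=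
    fun s => hasDerivAt_div_sqrt_sq_add hB s
  have hm1 : ∀ s, m s ^ 2 ≤ 1 := fun s => div_sqrt_sq_add_sq_le hA s
  have hn1 : ∀ s, n s ^ 2 ≤ 1 := fun s => div_sqrt_sq_add_sq_le hB s
  have S0 : ∀ s, 0 < X s + R s := fun s => add_pos (X0 s) (R0 s)
  have pw1 : ∀ s, (X s + R s) ^ (p - 1) = (X s + R s) ^ (p - 2) * (X s + R s) := by
    intro s; rw [← Real.rpow_add_one (S0 s).ne']; ring_nf
  have pw2 : ∀ s, (X s + R s) ^ (p - 2) = (X s + R s) ^ (p - 2 - 1) * (X s + R s) := by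
    intro s; rw [← Real.rpow_add_one (S0 s).ne']; ring_nf
  -- after squaring, this is a superlevel set of a concave quadratic polynomial because `c ≥ 1`
  have hconn : ({s | 0 ≤ R s - c * X s} : Set ℝ).OrdConnected := by
    have hiff : ∀ s, 0 ≤ R s - c * X s ↔
        0 ≤ ((s + β) ^ 2 + B) - c ^ 2 * ((s + α) ^ 2 + A) := by
      intro s
      rw [sub_nonneg, sub_nonneg, ← sq_le_sq₀ (mul_nonneg (by linarith) (X0 s).le) (R0 s).le,
        mul_pow, Real.sq_sqrt (by positivity), Real.sq_sqrt (by positivity)]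
    refine ⟨fun s₁ h₁ s₂ h₂ s hs => ?_⟩
    have h₁ := (hiff s₁).1 h₁
    have h₂ := (hiff s₂).1 h₂
    refine (hiff s).2 ?_
    rcases hs.1.eq_or_lt with rfl | hs1
    · exact h₁
    rcases hs.2.eq_or_lt with rfl | hs2
    · exact h₂
    have u : 0 < s - s₁ := by linarith
    have v : 0 < s₂ - s := by linarith
    have w : 0 < s₂ - s₁ := by linarith
    refine (mul_nonneg_iff_of_pos_right w).1 ?_
    have k1 := mul_nonneg h₁ v.le
    have k2 := mul_nonneg h₂ u.le
    have k3 : 0 ≤ (c ^ 2 - 1) * ((s - s₁) * (s₂ - s) * (s₂ - s₁)) :=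
      mul_nonneg (by nlinarith) (by positivity)
    linarith
  refine concaveOn_of_piecewise
    (f₁ := fun s => (R s - c * X s) * (X s + R s) ^ (p - 1))
    (f₂ := fun s => p ^ (p - 2) * (R s ^ p - (c * X s) ^ p))
    (d₁ := fun s => p * ((X s + R s) ^ (p - 2) * (R s * (m s + n s) - c * m s * (X s + R s))))
    (d₂ := fun s => p ^ (p - 2) *
      (n s * p * R s ^ (p - 1) - c * m s * p * (c * X s) ^ (p - 1)))
    (g := fun s => R s - c * X s) ?_ ?_ ?_ ?_ ?_ ?_ ?_
  · intro s
    simp only [burkholderFn, sub_nonpos]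
    rfl
  · intro s
    have d3 := ((dR s).sub ((dX s).const_mul c)).mul
      (((dX s).add (dR s)).rpow_const (p := p - 1) (Or.inl (S0 s).ne'))
    refine d3.congr_deriv ?_
    have e : p - 1 - 1 = p - 2 := by ring
    simp only [Pi.add_apply, Pi.sub_apply]
    rw [e, pw1]
    generalize (X s + R s) ^ (p - 2) = w
    linear_combination w * (m s * (X s + R s) - (m s + n s) * X s) * hcp
  · intro s
    exact (((dR s).rpow_const (p := p) (Or.inl (R0 s).ne')).sub
      (((dX s).const_mul c).rpow_const (p := p)
        (Or.inl (mul_pos (by linarith) (X0 s)).ne'))).const_mul _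
  · simp only [hX, hR]
    fun_prop
  · intro s hs
    have hs : R s = c * X s := by linarith [hs]
    refine ⟨by simp [hs], ?_⟩
    have e1 : X s + R s = p * R s := by
      rw [hs]; linear_combination X s * (-1) * hcp
    have e2 : (c * X s) ^ (p - 1) = R s ^ (p - 2) * R s := by
      rw [← hs, ← Real.rpow_add_one (R0 s).ne']; ring_nf
    have e3 : R s ^ (p - 1) = R s ^ (p - 2) * R s := by
      rw [← Real.rpow_add_one (R0 s).ne']; ring_nf
    rw [e2, e3, e1, Real.mul_rpow hp0.le (R0 s).le]
    generalize p ^ (p - 2) = v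
    generalize R s ^ (p - 2) = w
    linear_combination (p * v * w * R s * m s) * (-1) * hcp
  -- both terms of the second derivative are nonpositive because `p ≤ 2` and `c ≥ 1`
  · refine antitone_of_hasDerivAt_nonpos (f' := fun s => p * ((X s + R s) ^ (p - 2 - 1) *
      ((p - 2) * (m s + n s) ^ 2 * R s
        - (c - 1) * (X s + R s) ^ 2 * ((1 - m s ^ 2) / X s)))) ?_ ?_
    · intro s
      have d3 := ((((dX s).add (dR s)).rpow_const (p := p - 2) (Or.inl (S0 s).ne')).mul
        (((dR s).mul ((dm s).add (dn s))).sub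
          (((dm s).const_mul c).mul ((dX s).add (dR s))))).const_mul p
      refine d3.congr_deriv ?_
      simp only [Pi.add_apply, Pi.sub_apply, Pi.mul_apply]
      rw [pw2]
      have := X0 s
      have := R0 s
      have hcinv : c = 1 / (p - 1) := by rw [hc, one_div]
      rw [hcinv]
      generalize (X s + R s) ^ (p - 2 - 1) = w
      field_simp
      ring
    · intro s
      have h1 : 0 ≤ (X s + R s) ^ (p - 2 - 1) := Real.rpow_nonneg (S0 s).le _
      have h2 : (p - 2) * (m s + n s) ^ 2 * R s ≤ 0 :=
        mul_nonpos_of_nonpos_of_nonneg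
          (mul_nonpos_of_nonpos_of_nonneg (by linarith) (sq_nonneg _)) (R0 s).le
      have h3 : 0 ≤ (c - 1) * (X s + R s) ^ 2 * ((1 - m s ^ 2) / X s) :=
        mul_nonneg (mul_nonneg (by linarith) (sq_nonneg _))
          (div_nonneg (by linarith [hm1 s]) (X0 s).le)
      exact mul_nonpos_of_nonneg_of_nonpos hp0.le
        (mul_nonpos_of_nonneg_of_nonpos h1 (by linarith))
  · have d3 : ∀ s, HasDerivAt (fun s => p ^ (p - 2) *
        (n s * p * R s ^ (p - 1) - c * m s * p * (c * X s) ^ (p - 1)))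
        (p ^ (p - 2) * (p * (R s ^ (p - 2) * (1 + (p - 2) * n s ^ 2)
          - c ^ 2 * (c * X s) ^ (p - 2) * (1 + (p - 2) * m s ^ 2)))) s := by
      intro s
      have hcX : 0 < c * X s := mul_pos (by linarith) (X0 s)
      have d4 := ((((dn s).mul_const p).mul ((dR s).rpow_const (p := p - 1)
          (Or.inl (R0 s).ne'))).sub
        ((((dm s).const_mul c).mul_const p).mul (((dX s).const_mul c).rpow_const (p := p - 1)
          (Or.inl hcX.ne')))).const_mul (p ^ (p - 2))
      refine d4.congr_deriv ?_
      have e : p - 1 - 1 = p - 2 := by ring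
      have e1 : (c * X s) ^ (p - 1) = (c * X s) ^ (p - 2) * (c * X s) := by
        rw [← Real.rpow_add_one hcX.ne']; ring_nf
      have e3 : R s ^ (p - 1) = R s ^ (p - 2) * R s := by
        rw [← Real.rpow_add_one (R0 s).ne']; ring_nf
      rw [e, e1, e3]
      have := X0 s
      have := R0 s
      generalize (c * X s) ^ (p - 2) = w
      field_simp
      ring
    refine antitoneOn_of_deriv_nonpos hconn.convex ?_ ?_ ?_
    · exact fun s _ => (d3 s).continuousAt.continuousWithinAt
    · exact fun s _ => (d3 s).differentiableAt.differentiableWithinAt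
    · intro s hs
      have hs : s ∈ {s | 0 ≤ R s - c * X s} := interior_subset hs
      have hs : 0 ≤ R s - c * X s := hs
      rw [(d3 s).deriv]
      have hcX : 0 < c * X s := mul_pos (by linarith) (X0 s)
      have h1 : R s ^ (p - 2) ≤ (c * X s) ^ (p - 2) :=
        Real.rpow_le_rpow_of_nonpos hcX (by linarith) (by linarith)
      have h2 : 1 + (p - 2) * n s ^ 2 ≤ 1 := by nlinarith [sq_nonneg (n s)]
      have h3 : p - 1 ≤ 1 + (p - 2) * m s ^ 2 := by nlinarith [hm1 s]
      have h4 : 0 < (c * X s) ^ (p - 2) := Real.rpow_pos_of_pos hcX _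
      have h5 : R s ^ (p - 2) * (1 + (p - 2) * n s ^ 2) ≤ (c * X s) ^ (p - 2) := by
        have := Real.rpow_nonneg (R0 s).le (p - 2)
        nlinarith
      have h6 : (c * X s) ^ (p - 2)
          ≤ c ^ 2 * (c * X s) ^ (p - 2) * (1 + (p - 2) * m s ^ 2) := by
        have k1 : 1 ≤ c ^ 2 * (1 + (p - 2) * m s ^ 2) :=
          calc 1 ≤ c := hc1
            _ = c ^ 2 * (p - 1) := by linear_combination -c * hcp
            _ ≤ _ := by gcongr
        nlinarith
      have h7 : 0 < p ^ (p - 2) := Real.rpow_pos_of_pos hp0 _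
      exact mul_nonpos_of_nonneg_of_nonpos h7.le
        (mul_nonpos_of_nonneg_of_nonpos hp0.le (by linarith))

end Scalar

/-- Zigzag concavity of Burkholder's function: it is midpoint concave when both vectors move by
the same `h`. The line is perturbed so that it avoids the origins, which the addition of `ε` to
the squares of the norms achieves without a change of the ambient space. -/
theorem burkholderFn_add_le {E : Type*} [NormedAddCommGroup E] [InnerProductSpace ℝ E] {p : ℝ}
    (hp : 1 < p) (hp2 : p ≤ 2) (a b h : E) :
    burkholderFn p ‖a + h‖ ‖b + h‖ + burkholderFn p ‖a - h‖ ‖b - h‖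
      ≤ 2 * burkholderFn p ‖a‖ ‖b‖ := by
  rcases eq_or_ne h 0 with rfl | hh
  · simp [two_mul]
  set l := ‖h‖ with hl
  have hl0 : 0 < l := norm_pos_iff.2 hh
  have hsq : ∀ v : E, ∃ α A : ℝ, 0 ≤ A ∧ ‖v‖ ^ 2 = (0 + α) ^ 2 + A ∧
      ‖v + h‖ ^ 2 = (l + α) ^ 2 + A ∧ ‖v - h‖ ^ 2 = (-l + α) ^ 2 + A := by
    intro v
    have e : inner ℝ v h / l * l = inner ℝ v h := div_mul_cancel₀ _ hl0.ne'
    refine ⟨inner ℝ v h / l, ‖v‖ ^ 2 - (inner ℝ v h / l) ^ 2, ?_, by ring, ?_, ?_⟩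
    · have := abs_real_inner_le_norm v h
      have h1 : |inner ℝ v h / l| ≤ ‖v‖ := by
        rw [abs_div, abs_of_pos hl0]
        exact div_le_of_le_mul₀ hl0.le (norm_nonneg _) this
      have := sq_le_sq' (abs_le.1 h1).1 (abs_le.1 h1).2
      linarith
    · rw [norm_add_sq_real, ← hl]; linear_combination -2 * e
    · rw [norm_sub_sq_real, ← hl]; linear_combination 2 * e
  obtain ⟨α, A, hA, a0, a1, a2⟩ := hsq a
  obtain ⟨β, B, hB, b0, b1, b2⟩ := hsq b
  set U : ℝ → E → E → ℝ := fun ε v w => burkholderFn p √(‖v‖ ^ 2 + ε) √(‖w‖ ^ 2 + ε) with hU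
  have hUc : ∀ v w, Filter.Tendsto (fun ε => U ε v w) (nhdsWithin 0 (Set.Ioi 0))
      (nhds (burkholderFn p ‖v‖ ‖w‖)) := by
    intro v w
    have hc : Continuous fun ε => U ε v w :=
      (continuous_burkholderFn hp).comp (f := fun ε => (√(‖v‖ ^ 2 + ε), √(‖w‖ ^ 2 + ε)))
        (by fun_prop)
    have := hc.tendsto 0
    simp only [hU, add_zero, Real.sqrt_sq (norm_nonneg _)] at this
    exact this.mono_left nhdsWithin_le_nhds
  refine le_of_tendsto_of_tendsto ((hUc (a + h) (b + h)).add (hUc (a - h) (b - h)))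
    ((hUc a b).const_mul 2) ?_
  filter_upwards [self_mem_nhdsWithin] with ε hε
  have hε : 0 < ε := hε
  have := (concaveOn_burkholderFn_line hp hp2 (α := α) (A := A + ε) (β := β) (B := B + ε)
    (by linarith) (by linarith)).2 (Set.mem_univ l) (Set.mem_univ (-l))
    (show (0 : ℝ) ≤ 1 / 2 by norm_num) (show (0 : ℝ) ≤ 1 / 2 by norm_num) (by norm_num)
  have e : (1 / 2 : ℝ) • l + (1 / 2 : ℝ) • (-l) = 0 := by simp
  rw [e] at this
  simp only [← add_assoc, ← a0, ← a1, ← a2, ← b0, ← b1, ← b2, smul_eq_mul] at this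
  simp only [hU]
  linarith

/-! ### Supporting bounds, level curves, Young and Hölder inequalities -/

section Scalar

variable {p : ℝ}

theorem burkholderFn_of_le {x r : ℝ} (h : (p - 1)⁻¹ * x ≤ r) :
    burkholderFn p x r = p ^ (p - 2) * (r ^ p - ((p - 1)⁻¹ * x) ^ p) := by
  rcases h.eq_or_lt with h | h
  · rw [burkholderFn, if_pos h.ge, h]; simp
  · rw [burkholderFn, if_neg (not_le.2 h)]

theorem burkholderFn_mul {x y : ℝ} (hx : 0 < x) (hy : 0 ≤ y) (hyc : y ≤ (p - 1)⁻¹) :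
    burkholderFn p x (x * y) = -(x ^ p * levelFn p y) := by
  have h : x * y ≤ (p - 1)⁻¹ * x := by nlinarith
  have e : x + x * y = x * (1 + y) := by ring
  have e1 : x ^ p = x ^ (p - 1) * x := by rw [← Real.rpow_add_one hx.ne']; ring_nf
  rw [burkholderFn, if_pos h, e, Real.mul_rpow hx.le (by linarith), levelFn, e1]
  ring

theorem slopeFn_eq (p : ℝ) {y : ℝ} (hy : 0 < y) :
    slopeFn p y = y ^ (p - 1) * (y / (1 + y)) ^ (2 - p) := by
  have e1 : y = y ^ (p - 1) * y ^ (2 - p) := by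
    rw [← Real.rpow_add hy]; ring_nf; rw [Real.rpow_one]
  have e2 : (1 + y) ^ (p - 2) = ((1 + y) ^ (2 - p))⁻¹ := by
    rw [← Real.rpow_neg (by linarith)]; ring_nf
  rw [slopeFn, Real.div_rpow hy.le (by linarith), e2]
  nth_rw 1 [e1]
  ring

theorem div_one_add_le {a b : ℝ} (ha : 0 ≤ a) (hab : a ≤ b) : a / (1 + a) ≤ b / (1 + b) := by
  rw [div_le_div_iff₀ (by linarith) (by linarith)]
  nlinarith

/-- The increasing function `(y / (1 + y)) ^ (2 - p)`. It is the factor that turns `y ^ (p - 1)`, a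
multiple of the derivative of a power, into `slopeFn p y`. -/
noncomputable def weightFn (p y : ℝ) : ℝ := (y / (1 + y)) ^ (2 - p)

theorem weightFn_pos {y : ℝ} (hy : 0 < y) : 0 < weightFn p y :=
  Real.rpow_pos_of_pos (by positivity) _

theorem weightFn_mono (hp2 : p ≤ 2) {a b : ℝ} (ha : 0 ≤ a) (hab : a ≤ b) :
    weightFn p a ≤ weightFn p b :=
  Real.rpow_le_rpow (by positivity) (div_one_add_le ha hab) (by linarith)

theorem weightFn_inv (hp : 1 < p) : weightFn p (p - 1)⁻¹ = p ^ (p - 2) := by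
  have h : (p - 1)⁻¹ / (1 + (p - 1)⁻¹) = p⁻¹ := by
    have : p - 1 ≠ 0 := by linarith
    have : p ≠ 0 := by linarith
    field_simp
    ring_nf
    field_simp
  rw [weightFn, h, Real.inv_rpow (by linarith), ← Real.rpow_neg (by linarith)]
  ring_nf

/-- The function `weightFn p γ₀ * y ^ p + levelFn p y` is maximal at `y = γ₀`, since the sign of
its derivative is that of `weightFn p γ₀ - weightFn p y`. -/
theorem weight_mul_rpow_add_levelFn_le (hp : 1 < p) (hp2 : p ≤ 2) {γ₀ y : ℝ} (hγ : 0 < γ₀)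
    (hy : 0 ≤ y) :
    weightFn p γ₀ * y ^ p + levelFn p y ≤ weightFn p γ₀ * γ₀ ^ p + levelFn p γ₀ := by
  set g : ℝ → ℝ := fun y => weightFn p γ₀ * y ^ p + levelFn p y with hg
  have hd : ∀ y, 0 < y → HasDerivAt g
      (p * (y ^ (p - 1) * (weightFn p γ₀ - weightFn p y))) y := by
    intro y hy
    refine (((Real.hasDerivAt_rpow_const (p := p) (Or.inl hy.ne')).const_mul
      (weightFn p γ₀)).add (hasDerivAt_levelFn hp hy.le)).congr_deriv ?_
    rw [slopeFn_eq p hy, weightFn, weightFn]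
    ring
  have hc : ContinuousOn g (Set.Ici 0) := by
    have h1 : Continuous fun y : ℝ => y ^ p :=
      Continuous.rpow_const (by fun_prop) fun _ => Or.inr (by linarith)
    have := continuous_levelFn hp
    simp only [hg]
    fun_prop
  rcases le_total y γ₀ with h | h
  · have : MonotoneOn g (Set.Icc 0 γ₀) := by
      refine monotoneOn_of_deriv_nonneg (convex_Icc 0 γ₀) (hc.mono fun z hz => hz.1) ?_ ?_
      · rw [interior_Icc]
        exact fun z hz => (hd z hz.1).differentiableAt.differentiableWithinAt
      · rw [interior_Icc]
        intro z hz
        rw [(hd z hz.1).deriv]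
        have h1 := weightFn_mono hp2 hz.1.le hz.2.le
        have h2 := Real.rpow_nonneg hz.1.le (p - 1)
        exact mul_nonneg (by linarith) (mul_nonneg h2 (by linarith))
    exact this ⟨hy, h⟩ ⟨hγ.le, le_rfl⟩ h
  · have : AntitoneOn g (Set.Icc γ₀ y) := by
      refine antitoneOn_of_deriv_nonpos (convex_Icc γ₀ y)
        (hc.mono fun z hz => hγ.le.trans hz.1) ?_ ?_
      · rw [interior_Icc]
        exact fun z hz => (hd z (hγ.trans hz.1)).differentiableAt.differentiableWithinAt
      · rw [interior_Icc]
        intro z hz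
        have hz0 := hγ.trans hz.1
        rw [(hd z hz0).deriv]
        have h1 := weightFn_mono hp2 hγ.le hz.1.le
        have h2 := Real.rpow_nonneg hz0.le (p - 1)
        exact mul_nonpos_of_nonneg_of_nonpos (by linarith)
          (mul_nonpos_of_nonneg_of_nonpos h2 (by linarith))
    exact this ⟨le_rfl, h⟩ ⟨h, le_rfl⟩ h

/-- A lower bound of `û` by a combination of powers, with equality on the ray `R = γ₀ X`. -/
theorem le_burkholderFn (hp : 1 < p) (hp2 : p ≤ 2) {γ₀ X R : ℝ} (hγ : 0 < γ₀)
    (hγc : γ₀ ≤ (p - 1)⁻¹) (hX : 0 ≤ X) (hR : 0 ≤ R) :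
    weightFn p γ₀ * R ^ p - (weightFn p γ₀ * γ₀ ^ p + levelFn p γ₀) * X ^ p
      ≤ burkholderFn p X R := by
  have hc0 : 0 < (p - 1)⁻¹ := inv_pos.2 (by linarith)
  rcases le_or_gt ((p - 1)⁻¹ * X) R with h | h
  · rw [burkholderFn_of_le h, ← weightFn_inv hp]
    have h1 := weightFn_mono hp2 hγ.le hγc
    have h2 := weight_mul_rpow_add_levelFn_le hp hp2 hγ hc0.le
    rw [levelFn_inv, add_zero] at h2
    have h3 : ((p - 1)⁻¹ * X) ^ p ≤ R ^ p :=
      Real.rpow_le_rpow (by positivity) h (by linarith)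
    have h4 := Real.rpow_nonneg hX p
    rw [Real.mul_rpow hc0.le hX] at h3 ⊢
    nlinarith
  · have hX0 : 0 < X := by
      by_contra! h'
      have : (p - 1)⁻¹ * X ≤ 0 := mul_nonpos_of_nonneg_of_nonpos hc0.le h'
      linarith
    have hR' : R = X * (R / X) := by field_simp
    have hy : R / X ≤ (p - 1)⁻¹ := by rw [div_le_iff₀ hX0]; exact h.le
    have hy0 : 0 ≤ R / X := by positivity
    have h1 := weight_mul_rpow_add_levelFn_le hp hp2 hγ hy0
    rw [hR', burkholderFn_mul hX0 hy0 hy, Real.mul_rpow hX hy0]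
    have h4 := Real.rpow_nonneg hX p
    nlinarith

/-- A level curve of `û` in the outer part `r ≥ c x`, where it stays in the outer part and is
given by a power identity. -/
theorem exists_burkholderFn_eq_of_le (hp : 1 < p) {x X r : ℝ} (hx : 0 ≤ x) (hxX : x ≤ X)
    (hr : (p - 1)⁻¹ * x ≤ r) :
    ∃ R, (p - 1)⁻¹ * X ≤ R ∧ R ^ p = r ^ p + (((p - 1)⁻¹ * X) ^ p - ((p - 1)⁻¹ * x) ^ p) ∧
      burkholderFn p X R = burkholderFn p x r := by
  have hc0 : 0 < (p - 1)⁻¹ := inv_pos.2 (by linarith)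
  set c := (p - 1)⁻¹
  have hp0 : 0 < p := by linarith
  have hcx : 0 ≤ c * x := by positivity
  have hX : 0 ≤ X := hx.trans hxX
  have h1 : (c * x) ^ p ≤ r ^ p := Real.rpow_le_rpow hcx hr hp0.le
  have h2 : 0 ≤ (c * X) ^ p := Real.rpow_nonneg (by positivity) _
  have h3 : (c * X) ^ p ≤ r ^ p + ((c * X) ^ p - (c * x) ^ p) := by linarith
  have h4 : ((r ^ p + ((c * X) ^ p - (c * x) ^ p)) ^ p⁻¹) ^ p
      = r ^ p + ((c * X) ^ p - (c * x) ^ p) :=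
    Real.rpow_inv_rpow (h2.trans h3) hp0.ne'
  have h5 : c * X ≤ (r ^ p + ((c * X) ^ p - (c * x) ^ p)) ^ p⁻¹ := by
    rw [← Real.rpow_le_rpow_iff (by positivity) (Real.rpow_nonneg (h2.trans h3) _) hp0, h4]
    exact h3
  refine ⟨_, h5, h4, ?_⟩
  rw [burkholderFn_of_le h5, burkholderFn_of_le hr, h4]
  ring

/-- A level curve of `û` in the inner part `r ≤ c x`, in the slopes `Y = r / x` and
`γ = R / X`. -/
theorem exists_burkholderFn_eq_of_ge (hp : 1 < p) {x X r : ℝ} (hx : 0 < x) (hxX : x ≤ X)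
    (hr : 0 ≤ r) (hrc : r ≤ (p - 1)⁻¹ * x) :
    ∃ Y γ, r = x * Y ∧ 0 ≤ Y ∧ Y ≤ γ ∧ γ ≤ (p - 1)⁻¹ ∧
      x ^ p * levelFn p Y = X ^ p * levelFn p γ ∧
      burkholderFn p X (X * γ) = burkholderFn p x r := by
  have hX : 0 < X := hx.trans_le hxX
  have hxp := Real.rpow_pos_of_pos hx p
  have hXp := Real.rpow_pos_of_pos hX p
  have hle : x ^ p ≤ X ^ p := Real.rpow_le_rpow hx.le hxX (by linarith)
  have hr' : r = x * (r / x) := by field_simp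
  have hY0 : 0 ≤ r / x := by positivity
  have hYc : r / x ≤ (p - 1)⁻¹ := by rwa [div_le_iff₀ hx]
  have hN0 : 0 ≤ levelFn p (r / x) := by
    rcases hYc.eq_or_lt with h | h
    · rw [h, levelFn_inv]
    · exact (levelFn_pos hY0 h).le
  have hNc : levelFn p (r / x) ≤ (p - 1)⁻¹ := by
    have := le_levelFn_sub hp le_rfl hY0
    rw [slopeFn_zero, levelFn_zero] at this
    linarith
  have hq : x ^ p / X ^ p ≤ 1 := div_le_one_of_le₀ hle hXp.le
  have hq0 : 0 ≤ x ^ p / X ^ p := by positivity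
  obtain ⟨γ, h1, h2, h3⟩ := exists_levelFn_eq hp
    (v := x ^ p / X ^ p * levelFn p (r / x)) (by positivity) (by nlinarith)
  have h4 : x ^ p * levelFn p (r / x) = X ^ p * levelFn p γ := by
    rw [h3]; field_simp
  refine ⟨r / x, γ, hr', hY0, le_of_levelFn_le hp h1 (by rw [h3]; nlinarith), h2, h4, ?_⟩
  rw [burkholderFn_mul hX h1 h2, ← h4, ← burkholderFn_mul hx hY0 hYc, ← hr']

theorem young_scaled {q : ℝ} (hpq : p.HolderConjugate q) {s R E : ℝ} (hs : 0 < s) (hR : 0 ≤ R)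
    (hE : 0 ≤ E) : R * E ≤ s ^ p / p * R ^ p + s ^ (-q) / q * E ^ q := by
  have := Real.young_inequality_of_nonneg (a := s * R) (b := s⁻¹ * E) (by positivity)
    (by positivity) hpq
  rw [Real.mul_rpow hs.le hR, Real.mul_rpow (by positivity) hE, Real.inv_rpow hs.le,
    ← Real.rpow_neg hs.le] at this
  calc R * E = s * R * (s⁻¹ * E) := by field_simp
    _ ≤ _ := this
    _ = _ := by ring

theorem holder_two {q : ℝ} (hpq : p.HolderConjugate q) {a b u v : ℝ} (ha : 0 ≤ a) (hb : 0 ≤ b)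
    (hu : 0 ≤ u) (hv : 0 ≤ v) :
    a * u + b * v ≤ (a ^ p + b ^ p) ^ (1 / p) * (u ^ q + v ^ q) ^ (1 / q) := by
  have := Real.inner_le_Lp_mul_Lq Finset.univ ![a, b] ![u, v] hpq
  simpa [abs_of_nonneg ha, abs_of_nonneg hb, abs_of_nonneg hu, abs_of_nonneg hv] using this

end Scalar

/-! ### Lower bounds along the level curves and touching majorants -/

section Scalar

variable {p q : ℝ}

theorem rpow_sub_one_rpow (hpq : p.HolderConjugate q) {x : ℝ} (hx : 0 ≤ x) :
    (x ^ (p - 1)) ^ q = x ^ p := by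
  rw [← Real.rpow_mul hx, hpq.sub_one_mul_conj]

theorem rpow_sub_one_mul_self (hp : 1 < p) {x : ℝ} (hx : 0 ≤ x) : x ^ (p - 1) * x = x ^ p := by
  rcases hx.eq_or_lt with rfl | h
  · rw [mul_zero, Real.zero_rpow (by linarith)]
  · rw [← Real.rpow_add_one h.ne']; ring_nf

/-- The condition separating the two regions, after taking `q`-th roots. -/
theorem rpow_mul_le_iff (hpq : p.HolderConjugate q) {x e X E : ℝ} (hx : 0 ≤ x) (he : 0 ≤ e)
    (hX : 0 ≤ X) (hE : 0 ≤ E) :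
    x ^ p * E ^ q ≤ e ^ q * X ^ p ↔ x ^ (p - 1) * E ≤ e * X ^ (p - 1) := by
  have h1 := Real.rpow_nonneg hx (p - 1)
  have h2 := Real.rpow_nonneg hX (p - 1)
  rw [← rpow_sub_one_rpow hpq hx, ← rpow_sub_one_rpow hpq hX, ← Real.mul_rpow h1 hE,
    ← Real.mul_rpow he h2, Real.rpow_le_rpow_iff (by positivity) (by positivity) hpq.symm.pos]

/-- Hölder's inequality for `(r, D)` and `(e, F)`, where `D ^ p = c ^ p (X ^ p - x ^ p)` and
`F ^ q = E ^ q - e ^ q`, on the outer part of a level curve of `û`. -/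
theorem holder_curve (hp : 1 < p) (hpq : p.HolderConjugate q) {x e X E r R : ℝ} (hx : 0 ≤ x)
    (he : 0 ≤ e) (hxX : x ≤ X) (heE : e ≤ E) (hr : 0 ≤ r) (hR : 0 ≤ R)
    (h : R ^ p = r ^ p + (((p - 1)⁻¹ * X) ^ p - ((p - 1)⁻¹ * x) ^ p)) :
    (p - 1)⁻¹ * (X ^ p - x ^ p) ^ (1 / p) * (E ^ q - e ^ q) ^ (1 / q) ≤ R * E - r * e := by
  have hc : 0 ≤ (p - 1)⁻¹ := inv_nonneg.2 (by linarith)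
  have hp0 : p ≠ 0 := by linarith
  have h1 : 0 ≤ X ^ p - x ^ p := sub_nonneg.2 (Real.rpow_le_rpow hx hxX (by linarith))
  have h2 : 0 ≤ E ^ q - e ^ q := sub_nonneg.2 (Real.rpow_le_rpow he heE hpq.symm.nonneg)
  have := holder_two hpq hr (mul_nonneg hc (Real.rpow_nonneg h1 (1 / p))) he
    (Real.rpow_nonneg h2 (1 / q))
  have e1 : r ^ p + ((p - 1)⁻¹ * (X ^ p - x ^ p) ^ (1 / p)) ^ p = R ^ p := by
    rw [h, Real.mul_rpow hc (Real.rpow_nonneg h1 _), one_div, Real.rpow_inv_rpow h1 hp0,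
      Real.mul_rpow hc (hx.trans hxX), Real.mul_rpow hc hx]
    ring
  have e2 : e ^ q + ((E ^ q - e ^ q) ^ (1 / q)) ^ q = E ^ q := by
    rw [one_div, Real.rpow_inv_rpow h2 hpq.symm.ne_zero]; ring
  rw [e1, e2] at this
  simp only [one_div] at this ⊢
  rw [Real.rpow_rpow_inv hR hp0, Real.rpow_rpow_inv (he.trans heE) hpq.symm.ne_zero] at this
  linarith

/-- In the first region the product of the two defects bounds `R E - r e` from below along the
level curves of `û`. -/
theorem exists_curve_le_of_le (hp : 1 < p) (hpq : p.HolderConjugate q) {x e X E r : ℝ}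
    (hx : 0 ≤ x) (he : 0 ≤ e) (hxX : x ≤ X) (heE : e ≤ E) (hr : 0 ≤ r)
    (hreg : x ^ (p - 1) * E ≤ e * X ^ (p - 1)) :
    ∃ R, 0 ≤ R ∧ burkholderFn p X R = burkholderFn p x r ∧
      (p - 1)⁻¹ * (X ^ p - x ^ p) ^ (1 / p) * (E ^ q - e ^ q) ^ (1 / q) ≤ R * E - r * e := by
  have hc : 0 ≤ (p - 1)⁻¹ := inv_nonneg.2 (by linarith)
  have hE : 0 ≤ E := he.trans heE
  rcases le_total ((p - 1)⁻¹ * x) r with h | h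
  · obtain ⟨R, h1, h2, h3⟩ := exists_burkholderFn_eq_of_le hp hx hxX h
    have hR : 0 ≤ R := (mul_nonneg hc (hx.trans hxX)).trans h1
    exact ⟨R, hR, h3, holder_curve hp hpq hx he hxX heE hr hR h2⟩
  rcases hx.eq_or_lt with hx0 | hx0
  · subst hx0
    have hr0 : r = 0 := le_antisymm (by simpa using h) hr
    subst hr0
    obtain ⟨R, h1, h2, h3⟩ := exists_burkholderFn_eq_of_le hp le_rfl hxX (r := 0) (by simp)
    have hR : 0 ≤ R := (mul_nonneg hc hxX).trans h1
    exact ⟨R, hR, h3, holder_curve hp hpq le_rfl he hxX heE le_rfl hR h2⟩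
  obtain ⟨Y, γ, rfl, hY, hYγ, hγ, h1, h2⟩ := exists_burkholderFn_eq_of_ge hp hx0 hxX hr h
  have hX0 : 0 < X := hx0.trans_le hxX
  refine ⟨X * γ, mul_nonneg hX0.le (hY.trans hYγ), h2, ?_⟩
  have h3 := holder_curve hp hpq hx he hxX heE (mul_nonneg hc hx) (mul_nonneg hc hX0.le)
    (by ring)
  refine h3.trans ?_
  -- it remains to compare with the point `Y = γ = c`
  have hXp := Real.rpow_pos_of_pos hX0 p
  have hxp := Real.rpow_pos_of_pos hx0 p
  have hX1 := Real.rpow_pos_of_pos hX0 (p - 1)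
  have h4 : X ^ p * ((p - 1)⁻¹ - γ) ≤ x ^ p * ((p - 1)⁻¹ - Y) := by
    have hg : 0 < (1 + γ) ^ (p - 1) := Real.rpow_pos_of_pos (by linarith) _
    refine le_of_mul_le_mul_right ?_ hg
    have h5 : (1 + Y) ^ (p - 1) ≤ (1 + γ) ^ (p - 1) :=
      Real.rpow_le_rpow (by linarith) (by linarith) (by linarith)
    calc X ^ p * ((p - 1)⁻¹ - γ) * (1 + γ) ^ (p - 1)
        = x ^ p * ((p - 1)⁻¹ - Y) * (1 + Y) ^ (p - 1) := by
          simp only [levelFn] at h1; linarith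
      _ ≤ _ := mul_le_mul_of_nonneg_left h5 (mul_nonneg hxp.le (by linarith))
  have e1 := rpow_sub_one_mul_self hp hx
  have e2 := rpow_sub_one_mul_self hp hX0.le
  have h6 : ((p - 1)⁻¹ * X - X * γ) * E ≤ ((p - 1)⁻¹ * x - x * Y) * e := by
    refine le_of_mul_le_mul_right ?_ hX1
    calc ((p - 1)⁻¹ * X - X * γ) * E * X ^ (p - 1)
        = X ^ p * ((p - 1)⁻¹ - γ) * E := by rw [← e2]; ring
      _ ≤ x ^ p * ((p - 1)⁻¹ - Y) * E := mul_le_mul_of_nonneg_right h4 hE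
      _ = x * ((p - 1)⁻¹ - Y) * (x ^ (p - 1) * E) := by rw [← e1]; ring
      _ ≤ x * ((p - 1)⁻¹ - Y) * (e * X ^ (p - 1)) :=
          mul_le_mul_of_nonneg_left hreg (mul_nonneg hx (by linarith))
      _ = _ := by ring
  linarith

/-- In the second region, a minimum of `γ X E - Y x e` over the inner part of the level curves
bounds `R E - r e` from below along all of them. -/
theorem exists_curve_le_of_isMin (hp : 1 < p) (hpq : p.HolderConjugate q)
    {x e X E r v : ℝ} (hx : 0 < x) (he : 0 ≤ e) (hxX : x ≤ X) (hr : 0 ≤ r)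
    (hreg : e * X ^ (p - 1) ≤ x ^ (p - 1) * E)
    (hmin : ∀ Y γ, 0 ≤ Y → Y ≤ (p - 1)⁻¹ → 0 ≤ γ → γ ≤ (p - 1)⁻¹ →
      x ^ p * levelFn p Y = X ^ p * levelFn p γ → v ≤ X * γ * E - x * Y * e) :
    ∃ R, 0 ≤ R ∧ burkholderFn p X R = burkholderFn p x r ∧ v ≤ R * E - r * e := by
  have hc : 0 ≤ (p - 1)⁻¹ := inv_nonneg.2 (by linarith)
  have hX0 : 0 < X := hx.trans_le hxX
  rcases le_total ((p - 1)⁻¹ * x) r with h | h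
  · obtain ⟨R, h1, h2, h3⟩ := exists_burkholderFn_eq_of_le hp hx.le hxX h
    have hR : 0 ≤ R := (mul_nonneg hc hX0.le).trans h1
    refine ⟨R, hR, h3, ?_⟩
    have hX1 := Real.rpow_pos_of_pos hX0 (p - 1)
    have hx1 := Real.rpow_pos_of_pos hx (p - 1)
    have h4 := hmin _ _ hc le_rfl hc le_rfl (by simp [levelFn_inv])
    -- Hölder's inequality on the curve, for the exponents at which it is sharp at `r = c x`
    have h5 := holder_curve hp hpq hx.le hx1.le hxX
      (Real.rpow_le_rpow hx.le hxX (by linarith)) hr hR h2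
    have h6 : 0 ≤ X ^ p - x ^ p :=
      sub_nonneg.2 (Real.rpow_le_rpow hx.le hxX (by linarith))
    have e1 : (X ^ p - x ^ p) ^ (1 / p) * (X ^ p - x ^ p) ^ (1 / q) = X ^ p - x ^ p := by
      rcases h6.eq_or_lt with h0 | h0
      · rw [← h0, Real.zero_rpow (one_div_ne_zero hpq.ne_zero), zero_mul]
      · rw [← Real.rpow_add h0, one_div, one_div, hpq.inv_add_inv_eq_one, Real.rpow_one]
    rw [rpow_sub_one_rpow hpq hx.le, rpow_sub_one_rpow hpq hX0.le, mul_assoc, e1,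
      ← rpow_sub_one_mul_self hp hx.le, ← rpow_sub_one_mul_self hp hX0.le] at h5
    have h7 : (r - (p - 1)⁻¹ * x) * e ≤ (R - (p - 1)⁻¹ * X) * E := by
      refine le_of_mul_le_mul_right ?_ hX1
      have hE : 0 ≤ E := by
        have : 0 ≤ x ^ (p - 1) * E := (by positivity : 0 ≤ e * X ^ (p - 1)).trans hreg
        exact (mul_nonneg_iff_of_pos_left hx1).1 this
      calc (r - (p - 1)⁻¹ * x) * e * X ^ (p - 1)
          = (r - (p - 1)⁻¹ * x) * (e * X ^ (p - 1)) := by ring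
        _ ≤ (r - (p - 1)⁻¹ * x) * (x ^ (p - 1) * E) :=
            mul_le_mul_of_nonneg_left hreg (by linarith)
        _ = (r - (p - 1)⁻¹ * x) * x ^ (p - 1) * E := by ring
        _ ≤ (R - (p - 1)⁻¹ * X) * X ^ (p - 1) * E :=
            mul_le_mul_of_nonneg_right (by linarith) hE
        _ = _ := by ring
    linarith
  · obtain ⟨Y, γ, rfl, hY, hYγ, hγ, h1, h2⟩ := exists_burkholderFn_eq_of_ge hp hx hxX hr h
    exact ⟨X * γ, mul_nonneg hX0.le (hY.trans hYγ), h2,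
      hmin Y γ hY (hYγ.trans hγ) (hY.trans hYγ) hγ h1⟩

/-- A function of `(x, e, Z, H)` that is affine in `(Z, H)`, depends on the parameters `s`, `γ₀`
and `r`, and majorizes the Bellman function at `x = ‖ζ‖`, `e = ‖η‖`. -/
noncomputable def affineMajorant (p s γ₀ r x e Z H : ℝ) : ℝ :=
  s ^ p / (p * weightFn p γ₀) *
      (burkholderFn p x r + (weightFn p γ₀ * γ₀ ^ p + levelFn p γ₀) * Z)
    + s ^ (-Real.conjExponent p) / Real.conjExponent p * H - r * e

/-- The majorant lies above `v` as soon as `v ≤ R E - r e` at some point of the level curve of `û`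
through `(x, r)`: on that curve `û(x, r)` can be replaced by `û(X, R)`. -/
theorem le_affineMajorant (hp : 1 < p) (hp2 : p ≤ 2) {s γ₀ x e X E r v : ℝ} (hs : 0 < s)
    (hγ : 0 < γ₀) (hγc : γ₀ ≤ (p - 1)⁻¹) (hX : 0 ≤ X) (hE : 0 ≤ E)
    (h : ∃ R, 0 ≤ R ∧ burkholderFn p X R = burkholderFn p x r ∧ v ≤ R * E - r * e) :
    v ≤ affineMajorant p s γ₀ r x e (X ^ p) (E ^ Real.conjExponent p) := by
  obtain ⟨R, hR, h1, h2⟩ := h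
  have hp0 : 0 < p := by linarith
  have h3 := young_scaled (Real.HolderConjugate.conjExponent hp) hs hR hE
  have h4 := le_burkholderFn hp hp2 hγ hγc hX hR
  have hw := weightFn_pos (p := p) hγ
  have hsp := Real.rpow_pos_of_pos hs p
  have h5 : s ^ p / p * R ^ p ≤ s ^ p / (p * weightFn p γ₀) *
      (burkholderFn p x r + (weightFn p γ₀ * γ₀ ^ p + levelFn p γ₀) * X ^ p) :=
    calc s ^ p / p * R ^ p = s ^ p / (p * weightFn p γ₀) * (weightFn p γ₀ * R ^ p) := by
          field_simp
      _ ≤ _ := mul_le_mul_of_nonneg_left (by rw [← h1]; linarith) (by positivity)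
  rw [affineMajorant]
  linarith

/-- The equality case of Young's inequality `young_scaled`. -/
theorem young_scaled_eq (hp : 1 < p) (hpq : p.HolderConjugate q) {s R E : ℝ} (hs : 0 < s)
    (hR : 0 ≤ R) (h : E = s ^ p * R ^ (p - 1)) :
    s ^ p * R ^ p = R * E ∧ s ^ (-q) * E ^ q = R * E := by
  have e1 := rpow_sub_one_mul_self hp hR
  have h0 : s ^ p * R ^ p = R * E := by rw [h, ← e1]; ring
  refine ⟨h0, ?_⟩
  rw [← h0, h, Real.mul_rpow (Real.rpow_nonneg hs.le _) (Real.rpow_nonneg hR _),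
    rpow_sub_one_rpow hpq hR, ← Real.rpow_mul hs.le, ← mul_assoc, ← Real.rpow_add hs]
  congr 2
  have := hpq.mul_eq_add
  linarith

/-- In the interior of the first region some majorant touches the Bellman function. -/
theorem exists_touch_of_le (hp : 1 < p) (hq : q = Real.conjExponent p)
    {x e X E : ℝ} (hx : 0 ≤ x) (he : 0 ≤ e) (hxX : x < X) (heE : e < E)
    (hreg : x ^ p * E ^ q ≤ e ^ q * X ^ p) :
    ∃ s γ₀ r, 0 < s ∧ 0 < γ₀ ∧ γ₀ ≤ (p - 1)⁻¹ ∧ 0 ≤ r ∧ (e = 0 → r = 0) ∧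
      affineMajorant p s γ₀ r x e (X ^ p) (E ^ q)
        = (p - 1)⁻¹ * (X ^ p - x ^ p) ^ (1 / p) * (E ^ q - e ^ q) ^ (1 / q) := by
  have hpq : p.HolderConjugate q := hq ▸ Real.HolderConjugate.conjExponent hp
  have hp0 : 0 < p := by linarith
  have hc0 : 0 < (p - 1)⁻¹ := inv_pos.2 (by linarith)
  set c := (p - 1)⁻¹ with hc
  have hX : 0 < X := hx.trans_lt hxX
  have hd : 0 < X ^ p - x ^ p := sub_pos.2 (Real.rpow_lt_rpow hx hxX hp0)
  have hf : 0 < E ^ q - e ^ q := sub_pos.2 (Real.rpow_lt_rpow he heE hpq.symm.pos)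
  set D₁ := (X ^ p - x ^ p) ^ (1 / p) with hD₁
  set F := (E ^ q - e ^ q) ^ (1 / q) with hF
  have hD0 : 0 < D₁ := Real.rpow_pos_of_pos hd _
  have hF0 : 0 < F := Real.rpow_pos_of_pos hf _
  have hDp : D₁ ^ p = X ^ p - x ^ p := by
    rw [hD₁, one_div, Real.rpow_inv_rpow hd.le hp0.ne']
  have hFq : F ^ q = E ^ q - e ^ q := by
    rw [hF, one_div, Real.rpow_inv_rpow hf.le hpq.symm.ne_zero]
  have hcD : 0 < c * D₁ := mul_pos hc0 hD0
  have hcD1 := Real.rpow_pos_of_pos hcD (p - 1)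
  set σ := F / (c * D₁) ^ (p - 1) with hσ
  have hσ0 : 0 < σ := div_pos hF0 hcD1
  have hs0 : 0 < σ ^ (1 / p) := Real.rpow_pos_of_pos hσ0 _
  have hsp : (σ ^ (1 / p)) ^ p = σ := by rw [one_div, Real.rpow_inv_rpow hσ0.le hp0.ne']
  have hp1 : 0 < p - 1 := by linarith
  set r := (e / σ) ^ (p - 1)⁻¹ with hr
  have hr0 : 0 ≤ r := Real.rpow_nonneg (by positivity) _
  have hrp : r ^ (p - 1) = e / σ := Real.rpow_inv_rpow (by positivity) hp1.ne'
  have hcr : c * x ≤ r := by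
    rw [← Real.rpow_le_rpow_iff (by positivity) hr0 hp1, hrp, le_div_iff₀ hσ0, hσ,
      ← mul_div_assoc, div_le_iff₀ hcD1, Real.mul_rpow hc0.le hx, Real.mul_rpow hc0.le hD0.le]
    have k : x ^ (p - 1) * F ≤ e * D₁ ^ (p - 1) := by
      rw [← rpow_mul_le_iff hpq hx he hD0.le hF0.le, hDp, hFq]
      linarith
    have := mul_le_mul_of_nonneg_left k (Real.rpow_nonneg hc0.le (p - 1))
    linarith
  obtain ⟨y1, y2⟩ := young_scaled_eq hp hpq hs0 hr0 (E := e) (by rw [hsp, hrp]; field_simp)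
  obtain ⟨y3, y4⟩ := young_scaled_eq hp hpq hs0 hcD.le (E := F) (by rw [hsp, hσ]; field_simp)
  refine ⟨σ ^ (1 / p), c, r, hs0, hc0, le_rfl, hr0, ?_, ?_⟩
  · intro h
    rw [hr, h, zero_div, Real.zero_rpow hc0.ne']
  · have hw := weightFn_pos (p := p) hc0
    rw [affineMajorant, burkholderFn_of_le hcr, ← weightFn_inv hp, ← hc, ← hq, hc, levelFn_inv,
      ← hc, add_zero]
    have e1 : (σ ^ (1 / p)) ^ p / (p * weightFn p c) * (weightFn p c * (r ^ p - (c * x) ^ p)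
        + weightFn p c * c ^ p * X ^ p) = p⁻¹ * ((σ ^ (1 / p)) ^ p * r ^ p
          + (σ ^ (1 / p)) ^ p * (c * D₁) ^ p) := by
      rw [Real.mul_rpow hc0.le hx, Real.mul_rpow hc0.le hD0.le, hDp]
      field_simp
      ring
    have e2 : E ^ q = e ^ q + F ^ q := by rw [hFq]; ring
    rw [e1, y1, y3, e2]
    have e3 := hpq.inv_add_inv_eq_one
    linear_combination q⁻¹ * (y2 + y4) + (r * e + c * D₁ * F) * e3

/-- In the interior of the second region some majorant touches the Bellman function. -/
theorem exists_touch_of_system (hp : 1 < p) (hq : q = Real.conjExponent p)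
    {x e X E Y γ : ℝ} (hx : 0 < x) (hX : 0 < X) (hE : 0 < E) (hY : 0 ≤ Y)
    (hYγ : Y < γ) (hγ : γ < (p - 1)⁻¹) (hN : x ^ p * levelFn p Y = X ^ p * levelFn p γ)
    (hYe : e = 0 → Y = 0) :
    ∃ s γ₀ r, 0 < s ∧ 0 < γ₀ ∧ γ₀ ≤ (p - 1)⁻¹ ∧ 0 ≤ r ∧ (e = 0 → r = 0) ∧
      affineMajorant p s γ₀ r x e (X ^ p) (E ^ q) = γ * X * E - x * e * Y := by
  have hpq : p.HolderConjugate q := hq ▸ Real.HolderConjugate.conjExponent hp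
  have hp0 : 0 < p := by linarith
  have hγ0 : 0 < γ := hY.trans_lt hYγ
  have hR : 0 < γ * X := mul_pos hγ0 hX
  have hR1 := Real.rpow_pos_of_pos hR (p - 1)
  set σ := E / (γ * X) ^ (p - 1) with hσ
  have hσ0 : 0 < σ := div_pos hE hR1
  have hs0 : 0 < σ ^ (1 / p) := Real.rpow_pos_of_pos hσ0 _
  have hsp : (σ ^ (1 / p)) ^ p = σ := by rw [one_div, Real.rpow_inv_rpow hσ0.le hp0.ne']
  obtain ⟨y1, y2⟩ := young_scaled_eq hp hpq hs0 hR.le (E := E) (by rw [hsp, hσ]; field_simp)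
  refine ⟨σ ^ (1 / p), γ, x * Y, hs0, hγ0, hγ.le, mul_nonneg hx.le hY, ?_, ?_⟩
  · intro h
    rw [hYe h, mul_zero]
  · have hw := weightFn_pos (p := p) hγ0
    rw [affineMajorant, burkholderFn_mul hx hY (hYγ.le.trans hγ.le), hN, ← hq]
    have e1 : (σ ^ (1 / p)) ^ p / (p * weightFn p γ) * (-(X ^ p * levelFn p γ)
        + (weightFn p γ * γ ^ p + levelFn p γ) * X ^ p)
        = p⁻¹ * ((σ ^ (1 / p)) ^ p * (γ * X) ^ p) := by
      rw [Real.mul_rpow hγ0.le hX.le]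
      field_simp
      ring
    rw [e1, y1]
    have e3 := hpq.inv_add_inv_eq_one
    linear_combination q⁻¹ * y2 + γ * X * E * e3

end Scalar

/-! ### The explicit function and its majorants -/

section Bellman

variable {E : Type*} [NormedAddCommGroup E] {p : ℝ} {ζ η : E} {Z H : ℝ}

theorem isNTVSolution_iff (hp : 1 < p) (hζ : 0 < ‖ζ‖) (hZ : 0 < Z) (hH : 0 < H) {γ Y : ℝ} :
    IsNTVSolution p ζ η Z H (γ, Y) ↔ 0 ≤ Y ∧ Y < γ ∧ γ < (p - 1)⁻¹ ∧
      levelFn p Y = Z / ‖ζ‖ ^ p * levelFn p γ ∧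
      slopeFn p Y = ‖η‖ * (Z ^ (1 / p)) ^ (p - 1) /
        (‖ζ‖ ^ (p - 1) * H ^ (1 / Real.conjExponent p)) * slopeFn p γ := by
  set q := Real.conjExponent p with hq
  have hpq : p.HolderConjugate q := Real.HolderConjugate.conjExponent hp
  have hX := Real.rpow_pos_of_pos hZ (1 / p)
  have hE := Real.rpow_pos_of_pos hH (1 / q)
  have hx1 := Real.rpow_pos_of_pos hζ (p - 1)
  have hX1 := Real.rpow_pos_of_pos hX (p - 1)
  have hp1 : 0 < p - 1 := by linarith
  have hθ : ((‖η‖ ^ q * Z) / (‖ζ‖ ^ p * H)) ^ (1 / q)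
      = ‖η‖ * (Z ^ (1 / p)) ^ (p - 1) / (‖ζ‖ ^ (p - 1) * H ^ (1 / q)) := by
    have : (‖η‖ ^ q * Z) / (‖ζ‖ ^ p * H) =
        (‖η‖ * (Z ^ (1 / p)) ^ (p - 1) / (‖ζ‖ ^ (p - 1) * H ^ (1 / q))) ^ q := by
      rw [Real.div_rpow (by positivity) (by positivity), Real.mul_rpow (by positivity) hX1.le,
        Real.mul_rpow hx1.le hE.le, rpow_sub_one_rpow hpq hX.le, rpow_sub_one_rpow hpq hζ.le,
        one_div, one_div, Real.rpow_inv_rpow hZ.le hpq.ne_zero,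
        Real.rpow_inv_rpow hH.le hpq.symm.ne_zero]
    rw [this, one_div q, Real.rpow_rpow_inv (by positivity) hpq.symm.ne_zero]
  have hN : ∀ y, (1 - (p - 1) * y) * (1 + y) ^ (p - 1) = (p - 1) * levelFn p y := by
    intro y
    rw [levelFn]
    field_simp
  simp only [IsNTVSolution]
  rw [← hq, hθ, hN, hN]
  refine and_congr_right fun hY => and_congr_right fun hYγ => and_congr_right fun hγ => ?_
  have hγ0 := hY.trans_lt hYγ
  have h1 := levelFn_pos hγ0.le hγ
  have h2 := slopeFn_pos (p := p) hγ0
  refine and_congr ?_ ?_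
  · rw [mul_div_mul_left _ _ hp1.ne', div_eq_iff h1.ne']
  · exact div_eq_iff h2.ne'

/-- What the proof uses about the second region: the system has exactly one solution, and at this
solution `γ X E - Y x e` is minimal along the inner part of the level curves. -/
theorem explicitBellman_system (hp : 1 < p) (hH0 : 0 ≤ H)
    (hreg : ‖η‖ ^ Real.conjExponent p * Z < ‖ζ‖ ^ p * H) (hZ : ‖ζ‖ ^ p < Z) :
    (∃! s : ℝ × ℝ, IsNTVSolution p ζ η Z H s) ∧
    ∃ Y γ, 0 ≤ Y ∧ Y < γ ∧ γ < (p - 1)⁻¹ ∧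
      ‖ζ‖ ^ p * levelFn p Y = Z * levelFn p γ ∧ (‖η‖ = 0 → Y = 0) ∧
      explicitBellman p (ζ, η, Z, H)
        = γ * Z ^ (1 / p) * H ^ (1 / Real.conjExponent p) - ‖ζ‖ * ‖η‖ * Y ∧
      ∀ Y' γ', 0 ≤ Y' → Y' ≤ (p - 1)⁻¹ → 0 ≤ γ' → γ' ≤ (p - 1)⁻¹ →
        ‖ζ‖ ^ p * levelFn p Y' = Z * levelFn p γ' →
        explicitBellman p (ζ, η, Z, H)
          ≤ Z ^ (1 / p) * γ' * H ^ (1 / Real.conjExponent p) - ‖ζ‖ * Y' * ‖η‖ := by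
  set q := Real.conjExponent p with hq
  have hpq : p.HolderConjugate q := Real.HolderConjugate.conjExponent hp
  have hp0 : 0 < p := by linarith
  have hZ0 : 0 < Z := (Real.rpow_nonneg (norm_nonneg ζ) p).trans_lt hZ
  have hpos : 0 < ‖ζ‖ ^ p * H := lt_of_le_of_lt (by positivity) hreg
  have hH : 0 < H := by
    refine lt_of_le_of_ne hH0 fun h => ?_
    rw [← h, mul_zero] at hpos
    exact lt_irrefl _ hpos
  have hxp : 0 < ‖ζ‖ ^ p := (pos_iff_pos_of_mul_pos hpos).2 hH
  have hζ : 0 < ‖ζ‖ := by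
    refine lt_of_le_of_ne (norm_nonneg _) fun h => ?_
    rw [← h, Real.zero_rpow hp0.ne'] at hxp
    exact lt_irrefl _ hxp
  have hX := Real.rpow_pos_of_pos hZ0 (1 / p)
  have hE := Real.rpow_pos_of_pos hH (1 / q)
  have hXp : (Z ^ (1 / p)) ^ p = Z := by rw [one_div, Real.rpow_inv_rpow hZ0.le hp0.ne']
  have hEq : (H ^ (1 / q)) ^ q = H := by
    rw [one_div, Real.rpow_inv_rpow hH.le hpq.symm.ne_zero]
  have hiff := fun γ Y => isNTVSolution_iff (p := p) (η := η) hp hζ hZ0 hH (γ := γ) (Y := Y)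
  rw [← hq] at hiff
  set θ := ‖η‖ * (Z ^ (1 / p)) ^ (p - 1) / (‖ζ‖ ^ (p - 1) * H ^ (1 / q)) with hθ
  have hx1 := Real.rpow_pos_of_pos hζ (p - 1)
  have hX1 := Real.rpow_pos_of_pos hX (p - 1)
  have hM : 1 < Z / ‖ζ‖ ^ p := (one_lt_div hxp).2 hZ
  have hθ0 : 0 ≤ θ := by positivity
  have hθ1 : θ < 1 := by
    rw [hθ, div_lt_one (by positivity)]
    rw [← hXp, ← hEq] at hreg
    by_contra! h
    exact absurd ((rpow_mul_le_iff hpq hζ.le (norm_nonneg η) hX.le hE.le).2 h) (not_le.2 hreg)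
  obtain ⟨Y, γ, hY, hYγ, hγ, hN, hS, hmin⟩ := exists_system_isMin hp hM hθ0 hθ1
  have huniq : ∀ s, IsNTVSolution p ζ η Z H s → s = (γ, Y) := by
    rintro ⟨γ', Y'⟩ hs
    obtain ⟨h1, h2, h3, h4, h5⟩ := (hiff γ' Y').1 hs
    obtain ⟨h6, h7⟩ := system_unique hp hM h1 h2 h3 hY hYγ hγ h4 hN h5 hS
    rw [h6, h7]
  have hsol : IsNTVSolution p ζ η Z H (γ, Y) := (hiff γ Y).2 ⟨hY, hYγ, hγ, hN, hS⟩
  have heps : ntvSolution p ζ η Z H = (γ, Y) := huniq _ (Classical.epsilon_spec ⟨_, hsol⟩)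
  have hB : explicitBellman p (ζ, η, Z, H)
      = γ * Z ^ (1 / p) * H ^ (1 / q) - ‖ζ‖ * ‖η‖ * Y := by
    simp only [explicitBellman]
    rw [if_neg (not_le.2 hreg), if_neg hZ.ne', heps]
  refine ⟨⟨_, hsol, huniq⟩, Y, γ, hY, hYγ, hγ, ?_, ?_, hB, ?_⟩
  · rw [hN]; field_simp
  · intro h
    have hθz : θ = 0 := by rw [hθ, h, zero_mul, zero_div]
    by_contra hne
    have := slopeFn_pos (p := p) (lt_of_le_of_ne hY (Ne.symm hne))
    rw [hS, hθz, zero_mul] at this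
    exact lt_irrefl _ this
  · intro Y' γ' h1 h2 h3 h4 h5
    have h6 := hmin Y' γ' h1 h2 h3 h4 (by field_simp; linarith)
    -- multiply by `X E / M` and use `x e M = θ X E`
    have e1 : θ * (Z ^ (1 / p) * H ^ (1 / q)) = ‖ζ‖ * ‖η‖ * (Z / ‖ζ‖ ^ p) := by
      have a1 := rpow_sub_one_mul_self hp hζ.le
      have a2 := rpow_sub_one_mul_self hp hX.le
      rw [hXp] at a2
      have a3 : Z / ‖ζ‖ ^ p = (Z ^ (1 / p)) ^ (p - 1) * Z ^ (1 / p) / (‖ζ‖ ^ (p - 1) * ‖ζ‖) := by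
        rw [a1, a2]
      rw [a3, hθ]
      generalize (Z ^ (1 / p)) ^ (p - 1) = P
      field_simp
    have hM0 : 0 < Z / ‖ζ‖ ^ p := by linarith
    have h7 := mul_le_mul_of_nonneg_right h6 (mul_pos hX hE).le
    rw [hB]
    refine le_of_mul_le_mul_left ?_ hM0
    linear_combination h7 + (Y - Y') * e1

theorem explicitBellman_of_ge (hreg : ‖ζ‖ ^ p * H ≤ ‖η‖ ^ Real.conjExponent p * Z) :
    explicitBellman p (ζ, η, Z, H) = (p - 1)⁻¹ * (Z - ‖ζ‖ ^ p) ^ (1 / p)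
      * (H - ‖η‖ ^ Real.conjExponent p) ^ (1 / Real.conjExponent p) := by
  simp only [explicitBellman]
  rw [if_pos hreg]
  ring

theorem explicitBellman_of_eq_left (hp : 1 < p) (hZ : Z = ‖ζ‖ ^ p) :
    explicitBellman p (ζ, η, Z, H) = 0 := by
  rcases le_or_gt (‖ζ‖ ^ p * H) (‖η‖ ^ Real.conjExponent p * Z) with h | h
  · rw [explicitBellman_of_ge h, hZ, sub_self,
      Real.zero_rpow (one_div_ne_zero (by linarith))]
    ring
  · simp only [explicitBellman]
    rw [if_neg (not_le.2 h), if_pos hZ]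

theorem explicitBellman_of_eq_right (hp : 1 < p) (hZ : ‖ζ‖ ^ p ≤ Z)
    (hH : H = ‖η‖ ^ Real.conjExponent p) : explicitBellman p (ζ, η, Z, H) = 0 := by
  have hpq := Real.HolderConjugate.conjExponent hp
  have h0 : 0 ≤ H := hH ▸ Real.rpow_nonneg (norm_nonneg η) _
  rw [explicitBellman_of_ge (by rw [← hH, mul_comm]; exact mul_le_mul_of_nonneg_left hZ h0),
    ← hH, sub_self, Real.zero_rpow (one_div_ne_zero hpq.symm.ne_zero), mul_zero]

theorem norm_le_rpow_one_div {s : ℝ} (hs : 0 < s) {a : ℝ} (ha : 0 ≤ a) {W : ℝ}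
    (h : a ^ s ≤ W) : a ≤ W ^ (1 / s) := by
  have := Real.rpow_le_rpow (Real.rpow_nonneg ha s) h (one_div_nonneg.2 hs.le)
  rwa [one_div, Real.rpow_rpow_inv ha hs.ne', ← one_div] at this

/-- Every majorant of the family lies above the explicit function on the whole domain. -/
theorem explicitBellman_le_affineMajorant (hp : 1 < p) (hp2 : p ≤ 2)
    (ha : (ζ, η, Z, H) ∈ ntvDomain E p) {s γ₀ r : ℝ} (hs : 0 < s) (hγ : 0 < γ₀)
    (hγc : γ₀ ≤ (p - 1)⁻¹) (hr : 0 ≤ r) :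
    explicitBellman p (ζ, η, Z, H) ≤ affineMajorant p s γ₀ r ‖ζ‖ ‖η‖ Z H := by
  obtain ⟨hZ0, hH0, hZ, hH⟩ := ha
  set q := Real.conjExponent p with hq
  have hpq : p.HolderConjugate q := Real.HolderConjugate.conjExponent hp
  have hX : 0 ≤ Z ^ (1 / p) := Real.rpow_nonneg hZ0 _
  have hE : 0 ≤ H ^ (1 / q) := Real.rpow_nonneg hH0 _
  have hXp : (Z ^ (1 / p)) ^ p = Z := by rw [one_div, Real.rpow_inv_rpow hZ0 hpq.ne_zero]
  have hEq : (H ^ (1 / q)) ^ q = H := by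
    rw [one_div, Real.rpow_inv_rpow hH0 hpq.symm.ne_zero]
  have hxX : ‖ζ‖ ≤ Z ^ (1 / p) := norm_le_rpow_one_div hpq.pos (norm_nonneg _) hZ
  have heE : ‖η‖ ≤ H ^ (1 / q) := norm_le_rpow_one_div hpq.symm.pos (norm_nonneg _) hH
  have key := fun h => le_affineMajorant (v := explicitBellman p (ζ, η, Z, H)) (r := r)
    (x := ‖ζ‖) (e := ‖η‖) hp hp2 hs hγ hγc hX hE h
  rw [← hq, hXp, hEq] at key
  refine key ?_
  rcases le_or_gt (‖ζ‖ ^ p * H) (‖η‖ ^ q * Z) with hreg | hreg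
  · rw [explicitBellman_of_ge hreg]
    have h1 : ‖ζ‖ ^ (p - 1) * H ^ (1 / q) ≤ ‖η‖ * (Z ^ (1 / p)) ^ (p - 1) := by
      rw [← rpow_mul_le_iff hpq (norm_nonneg _) (norm_nonneg _) hX hE, hXp, hEq]
      exact hreg
    have := exists_curve_le_of_le hp hpq (norm_nonneg ζ) (norm_nonneg η) hxX heE hr h1
    rwa [hXp, hEq] at this
  · rcases hZ.eq_or_lt with hZe | hZlt
    · rw [explicitBellman_of_eq_left hp hZe.symm]
      refine ⟨r, hr, ?_, ?_⟩
      · rw [← hZe, one_div, Real.rpow_rpow_inv (norm_nonneg _) hpq.ne_zero]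
      · have := mul_le_mul_of_nonneg_left heE hr
        linarith
    · obtain ⟨-, Y, γ, -, -, -, -, -, -, hmin⟩ := explicitBellman_system hp hH0 hreg hZlt
      have hζ : 0 < ‖ζ‖ := by
        refine lt_of_le_of_ne (norm_nonneg _) fun h => ?_
        rw [← h, Real.zero_rpow hpq.ne_zero, zero_mul] at hreg
        exact absurd hreg (not_lt.2 (by positivity))
      have h1 : ‖η‖ * (Z ^ (1 / p)) ^ (p - 1) ≤ ‖ζ‖ ^ (p - 1) * H ^ (1 / q) := by
        by_contra! h
        have := (rpow_mul_le_iff hpq (norm_nonneg ζ) (norm_nonneg η) hX hE).2 h.le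
        rw [hXp, hEq] at this
        exact absurd hreg (not_lt.2 this)
      refine exists_curve_le_of_isMin hp hpq hζ (norm_nonneg η) hxX hr h1 ?_
      rw [hXp]
      exact hmin

/-- At every interior point of the domain some majorant of the family coincides with the explicit
function. -/
theorem exists_affineMajorant_eq (hp : 1 < p) (hZ0 : 0 ≤ Z) (hH0 : 0 ≤ H) (hZ : ‖ζ‖ ^ p < Z)
    (hH : ‖η‖ ^ Real.conjExponent p < H) :
    ∃ s γ₀ r, 0 < s ∧ 0 < γ₀ ∧ γ₀ ≤ (p - 1)⁻¹ ∧ 0 ≤ r ∧ (‖η‖ = 0 → r = 0) ∧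
      affineMajorant p s γ₀ r ‖ζ‖ ‖η‖ Z H = explicitBellman p (ζ, η, Z, H) := by
  set q := Real.conjExponent p with hq
  have hpq : p.HolderConjugate q := Real.HolderConjugate.conjExponent hp
  have hX : 0 ≤ Z ^ (1 / p) := Real.rpow_nonneg hZ0 _
  have hE : 0 ≤ H ^ (1 / q) := Real.rpow_nonneg hH0 _
  have hXp : (Z ^ (1 / p)) ^ p = Z := by rw [one_div, Real.rpow_inv_rpow hZ0 hpq.ne_zero]
  have hEq : (H ^ (1 / q)) ^ q = H := by
    rw [one_div, Real.rpow_inv_rpow hH0 hpq.symm.ne_zero]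
  have hxX : ‖ζ‖ < Z ^ (1 / p) := by
    rw [← Real.rpow_lt_rpow_iff (norm_nonneg _) hX hpq.pos, hXp]; exact hZ
  have heE : ‖η‖ < H ^ (1 / q) := by
    rw [← Real.rpow_lt_rpow_iff (norm_nonneg _) hE hpq.symm.pos, hEq]; exact hH
  rcases le_or_gt (‖ζ‖ ^ p * H) (‖η‖ ^ q * Z) with hreg | hreg
  · rw [explicitBellman_of_ge hreg]
    have := exists_touch_of_le hp hq (norm_nonneg ζ) (norm_nonneg η) hxX heE
      (by rw [hXp, hEq]; exact hreg)
    rwa [hXp, hEq] at this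
  · obtain ⟨-, Y, γ, hY, hYγ, hγ, hN, hYe, hB, -⟩ := explicitBellman_system hp hH0 hreg hZ
    have hζ : 0 < ‖ζ‖ := by
      refine lt_of_le_of_ne (norm_nonneg _) fun h => ?_
      rw [← h, Real.zero_rpow hpq.ne_zero, zero_mul] at hreg
      exact absurd hreg (not_lt.2 (by positivity))
    rw [hB]
    have := exists_touch_of_system (e := ‖η‖) hp hq hζ ((norm_nonneg _).trans_lt hxX)
      ((norm_nonneg _).trans_lt heE) hY hYγ hγ (by rw [hXp]; exact hN) hYe
    rwa [hXp, hEq] at this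

theorem explicitBellman_bounds (hp : 1 < p) (ha : (ζ, η, Z, H) ∈ ntvDomain E p) :
    0 ≤ explicitBellman p (ζ, η, Z, H) ∧
    explicitBellman p (ζ, η, Z, H)
      ≤ (p - 1)⁻¹ * Z ^ (1 / p) * H ^ (1 / Real.conjExponent p) := by
  obtain ⟨hZ0, hH0, hZ, hH⟩ := ha
  set q := Real.conjExponent p with hq
  have hpq : p.HolderConjugate q := Real.HolderConjugate.conjExponent hp
  have hX : 0 ≤ Z ^ (1 / p) := Real.rpow_nonneg hZ0 _
  have hE : 0 ≤ H ^ (1 / q) := Real.rpow_nonneg hH0 _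
  have hc : 0 ≤ (p - 1)⁻¹ := inv_nonneg.2 (by linarith)
  rcases le_or_gt (‖ζ‖ ^ p * H) (‖η‖ ^ q * Z) with hreg | hreg
  · rw [explicitBellman_of_ge hreg]
    have h1 : 0 ≤ Z - ‖ζ‖ ^ p := by linarith
    have h2 : 0 ≤ H - ‖η‖ ^ q := by linarith
    have h3 : (Z - ‖ζ‖ ^ p) ^ (1 / p) ≤ Z ^ (1 / p) :=
      Real.rpow_le_rpow h1 (by linarith [Real.rpow_nonneg (norm_nonneg ζ) p])
        (one_div_nonneg.2 hpq.nonneg)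
    have h4 : (H - ‖η‖ ^ q) ^ (1 / q) ≤ H ^ (1 / q) :=
      Real.rpow_le_rpow h2 (by linarith [Real.rpow_nonneg (norm_nonneg η) q])
        (one_div_nonneg.2 hpq.symm.nonneg)
    refine ⟨by positivity, by gcongr⟩
  rcases hZ.eq_or_lt with hZe | hZlt
  · rw [explicitBellman_of_eq_left hp hZe.symm]
    exact ⟨le_rfl, by positivity⟩
  obtain ⟨-, Y, γ, hY, hYγ, hγ, -, -, hB, -⟩ := explicitBellman_system hp hH0 hreg hZlt
  have hxX : ‖ζ‖ ≤ Z ^ (1 / p) := norm_le_rpow_one_div hpq.pos (norm_nonneg _) hZ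
  have heE : ‖η‖ ≤ H ^ (1 / q) := norm_le_rpow_one_div hpq.symm.pos (norm_nonneg _) hH
  have h1 : ‖ζ‖ * ‖η‖ * Y ≤ Z ^ (1 / p) * H ^ (1 / q) * γ := by gcongr
  have h2 : γ * Z ^ (1 / p) * H ^ (1 / q) ≤ (p - 1)⁻¹ * Z ^ (1 / p) * H ^ (1 / q) := by
    gcongr
  have h3 : 0 ≤ ‖ζ‖ * ‖η‖ * Y := by positivity
  rw [hB]
  exact ⟨by linarith, by linarith⟩

end Bellman

/-! ### The concavity condition -/

section InnerProduct

variable {E : Type*} [NormedAddCommGroup E] [InnerProductSpace ℝ E]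

/-- Strict convexity of `‖·‖ ^ s`: a midpoint on the boundary `W = ‖z‖ ^ s` of the epigraph comes
from two equal vectors on the boundary. -/
theorem eq_of_norm_midpoint_rpow {s : ℝ} (hs : 1 < s) {z₁ z₂ : E} {W₁ W₂ : ℝ}
    (h₁ : ‖z₁‖ ^ s ≤ W₁) (h₂ : ‖z₂‖ ^ s ≤ W₂)
    (h : (W₁ + W₂) / 2 ≤ ‖(1 / 2 : ℝ) • (z₁ + z₂)‖ ^ s) :
    z₁ = z₂ ∧ W₁ = ‖z₁‖ ^ s ∧ W₂ = ‖z₂‖ ^ s := by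
  have hm : ‖(1 / 2 : ℝ) • (z₁ + z₂)‖ ≤ (‖z₁‖ + ‖z₂‖) / 2 := by
    rw [norm_smul, Real.norm_of_nonneg (by norm_num)]
    linarith [norm_add_le z₁ z₂]
  have hm2 : ‖(1 / 2 : ℝ) • (z₁ + z₂)‖ ^ s ≤ ((‖z₁‖ + ‖z₂‖) / 2) ^ s :=
    Real.rpow_le_rpow (norm_nonneg _) hm (by linarith)
  have heq : ‖z₁‖ = ‖z₂‖ := by
    by_contra hne
    have := (strictConvexOn_rpow hs).2 (norm_nonneg z₁) (norm_nonneg z₂) hne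
      (show (0 : ℝ) < 1 / 2 by norm_num) (show (0 : ℝ) < 1 / 2 by norm_num) (by norm_num)
    simp only [smul_eq_mul] at this
    have e : 1 / 2 * ‖z₁‖ + 1 / 2 * ‖z₂‖ = (‖z₁‖ + ‖z₂‖) / 2 := by ring
    rw [e] at this
    linarith
  have e : (‖z₁‖ + ‖z₂‖) / 2 = ‖z₁‖ := by rw [heq]; ring
  rw [e] at hm hm2
  have hpow : ‖z₁‖ ^ s ≤ ‖(1 / 2 : ℝ) • (z₁ + z₂)‖ ^ s := by rw [← heq] at h₂; linarith
  have hge : ‖z₁‖ ≤ ‖(1 / 2 : ℝ) • (z₁ + z₂)‖ :=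
    (Real.rpow_le_rpow_iff (norm_nonneg _) (norm_nonneg _) (by linarith)).1 hpow
  refine ⟨?_, ?_, ?_⟩
  · rw [norm_smul, Real.norm_of_nonneg (by norm_num)] at hge
    have hpar := parallelogram_law_with_norm ℝ z₁ z₂
    rw [← heq] at hpar
    have h0 : ‖z₁ - z₂‖ = 0 := by
      have h3 : 2 * ‖z₁‖ ≤ ‖z₁ + z₂‖ := by linarith
      have h4 : 2 * ‖z₁‖ * (2 * ‖z₁‖) ≤ ‖z₁ + z₂‖ * ‖z₁ + z₂‖ := by gcongr
      nlinarith [norm_nonneg (z₁ - z₂)]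
    exact sub_eq_zero.1 (norm_eq_zero.1 h0)
  · rw [← heq] at h₂; linarith
  · rw [← heq] at h₂ ⊢; linarith

/-- A reflection turns `k` into the direction of `h`. -/
theorem exists_isometry_inner_eq (h k : E) :
    ∃ T : E →ₗᵢ[ℝ] E, inner ℝ h (T k) = ‖h‖ * ‖k‖ := by
  rcases eq_or_ne h 0 with rfl | hh
  · exact ⟨LinearIsometry.id, by simp⟩
  have hh' : ‖h‖ ≠ 0 := norm_ne_zero_iff.2 hh
  have hn : ‖k‖ = ‖(‖k‖ / ‖h‖) • h‖ := by
    rw [norm_smul, Real.norm_of_nonneg (by positivity)]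
    field_simp
  refine ⟨((ℝ ∙ (k - (‖k‖ / ‖h‖) • h))ᗮ.reflection).toLinearIsometry, ?_⟩
  have : (ℝ ∙ (k - (‖k‖ / ‖h‖) • h))ᗮ.reflection k = (‖k‖ / ‖h‖) • h :=
    Submodule.reflection_sub hn
  simp only [LinearIsometryEquiv.coe_toLinearIsometry]
  rw [this, inner_smul_right, real_inner_self_eq_norm_sq]
  field_simp

theorem exists_norm_eq_inner_eq (η : E) {r : ℝ} (hr : 0 ≤ r) (h : ‖η‖ = 0 → r = 0) :
    ∃ y : E, ‖y‖ = r ∧ inner ℝ y η = r * ‖η‖ := by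
  rcases eq_or_ne ‖η‖ 0 with h0 | h0
  · exact ⟨0, by simp [h h0], by simp [h0]⟩
  · refine ⟨(r / ‖η‖) • η, ?_, ?_⟩
    · rw [norm_smul, Real.norm_of_nonneg (by positivity)]
      field_simp
    · rw [real_inner_smul_left, real_inner_self_eq_norm_sq]
      field_simp

/-- The concavity condition for the majorants: for the parameter `r` at the midpoint it holds
with suitable parameters `r₁`, `r₂` at the end points. -/
theorem exists_affineMajorant_add_le {p : ℝ} (hp : 1 < p) (hp2 : p ≤ 2) {s γ₀ r : ℝ}
    (hs : 0 < s) (hγ : 0 < γ₀) (hr : 0 ≤ r) {ζ η : E} (hrη : ‖η‖ = 0 → r = 0) (h k : E)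
    (Z H Z' H' : ℝ) :
    ∃ r₁ r₂, 0 ≤ r₁ ∧ 0 ≤ r₂ ∧
      affineMajorant p s γ₀ r₁ ‖ζ - h‖ ‖η - k‖ Z H
        + affineMajorant p s γ₀ r₂ ‖ζ + h‖ ‖η + k‖ Z' H' + 2 * (‖h‖ * ‖k‖)
      ≤ 2 * affineMajorant p s γ₀ r ‖ζ‖ ‖η‖ ((Z + Z') / 2) ((H + H') / 2) := by
  obtain ⟨T, hT⟩ := exists_isometry_inner_eq h k
  obtain ⟨y, hy, hyη⟩ := exists_norm_eq_inner_eq η hr hrη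
  refine ⟨‖T y - h‖, ‖T y + h‖, norm_nonneg _, norm_nonneg _, ?_⟩
  have hκ : 0 ≤ s ^ p / (p * weightFn p γ₀) := by
    have := weightFn_pos (p := p) hγ
    positivity
  have hU := mul_le_mul_of_nonneg_left (burkholderFn_add_le hp hp2 ζ (T y) h) hκ
  have i1 := real_inner_le_norm (T y - h) (T (η - k))
  have i2 := real_inner_le_norm (T y + h) (T (η + k))
  rw [T.norm_map, map_sub, inner_sub_left, inner_sub_right, inner_sub_right, T.inner_map_map,
    T.inner_map_map, hT, hyη] at i1
  rw [T.norm_map, map_add, inner_add_left, inner_add_right, inner_add_right, T.inner_map_map,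
    T.inner_map_map, hT, hyη] at i2
  rw [T.norm_map, hy] at hU
  simp only [affineMajorant]
  linarith

theorem explicitBellman_conditionII {p : ℝ} (hp : 1 < p) (hp2 : p ≤ 2) :
    NTVConditionII p (explicitBellman p : E × E × ℝ × ℝ → ℝ) := by
  intro ζ₁ η₁ Z₁ H₁ ζ₂ η₂ Z₂ H₂ ha₁ ha₂
  have hpq := Real.HolderConjugate.conjExponent hp
  have h₁ := ha₁
  have h₂ := ha₂
  obtain ⟨hZ₁0, hH₁0, hZ₁, hH₁⟩ := h₁
  obtain ⟨hZ₂0, hH₂0, hZ₂, hH₂⟩ := h₂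
  rcases le_or_gt ((Z₁ + Z₂) / 2) (‖(1 / 2 : ℝ) • (ζ₁ + ζ₂)‖ ^ p) with hZ | hZ
  · obtain ⟨h1, h2, h3⟩ := eq_of_norm_midpoint_rpow hp hZ₁ hZ₂ hZ
    subst h1
    have e : (1 / 2 : ℝ) • (ζ₁ + ζ₁) = ζ₁ := by rw [smul_add, ← add_smul]; norm_num
    have h4 : (Z₁ + Z₂) / 2 = ‖(1 / 2 : ℝ) • (ζ₁ + ζ₁)‖ ^ p := by rw [e, h2, h3]; ring
    rw [explicitBellman_of_eq_left hp h2, explicitBellman_of_eq_left hp h3,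
      explicitBellman_of_eq_left hp h4]
    simp
  rcases le_or_gt ((H₁ + H₂) / 2) (‖(1 / 2 : ℝ) • (η₁ + η₂)‖ ^ Real.conjExponent p)
    with hH | hH
  · obtain ⟨h1, h2, h3⟩ := eq_of_norm_midpoint_rpow hpq.symm.lt hH₁ hH₂ hH
    subst h1
    have e : (1 / 2 : ℝ) • (η₁ + η₁) = η₁ := by rw [smul_add, ← add_smul]; norm_num
    have h4 : (H₁ + H₂) / 2 = ‖(1 / 2 : ℝ) • (η₁ + η₁)‖ ^ Real.conjExponent p := by
      rw [e, h2, h3]; ring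
    rw [explicitBellman_of_eq_right hp hZ₁ h2, explicitBellman_of_eq_right hp hZ₂ h3,
      explicitBellman_of_eq_right hp hZ.le h4]
    simp
  obtain ⟨s, γ₀, r, hs, hγ, hγc, hr, hrη, hB⟩ :=
    exists_affineMajorant_eq hp (by linarith) (by linarith) hZ hH
  obtain ⟨r₁, r₂, hr₁, hr₂, hle⟩ := exists_affineMajorant_add_le hp hp2 hs hγ hr hrη
    (ζ := (1 / 2 : ℝ) • (ζ₁ + ζ₂)) ((1 / 2 : ℝ) • (ζ₂ - ζ₁)) ((1 / 2 : ℝ) • (η₂ - η₁))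
    Z₁ H₁ Z₂ H₂
  have em : ∀ u v : E, (1 / 2 : ℝ) • (u + v) - (1 / 2 : ℝ) • (v - u) = u := by
    intro u v; module
  have ep : ∀ u v : E, (1 / 2 : ℝ) • (u + v) + (1 / 2 : ℝ) • (v - u) = v := by
    intro u v; module
  rw [em, em, ep, ep, hB] at hle
  have b1 := explicitBellman_le_affineMajorant hp hp2 ha₁ hs hγ hγc hr₁
  have b2 := explicitBellman_le_affineMajorant hp hp2 ha₂ hs hγ hγc hr₂
  linarith

end InnerProduct

/-! ### Condition (I) and the passage to the conjugate exponent -/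

theorem explicitBellman_conditionI {E : Type*} [NormedAddCommGroup E] {p : ℝ} (hp : 1 < p)
    (hp2 : p ≤ 2) : NTVConditionI p (explicitBellman p : E × E × ℝ × ℝ → ℝ) := by
  intro ζ η Z H ha
  have hp1 : 0 < p - 1 := by linarith
  have e : max p (p / (p - 1)) - 1 = (p - 1)⁻¹ := by
    rw [max_eq_right]
    · field_simp; ring
    · rw [le_div_iff₀ hp1]; nlinarith
  rw [e]
  exact explicitBellman_bounds hp ha

theorem mem_ntvDomain_swap {E : Type*} [NormedAddCommGroup E] {p q : ℝ}
    (hpq : p.HolderConjugate q) {ζ η : E} {Z H : ℝ} (ha : (ζ, η, Z, H) ∈ ntvDomain E p) :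
    (η, ζ, H, Z) ∈ ntvDomain E q := by
  obtain ⟨h1, h2, h3, h4⟩ := ha
  have e1 : q = Real.conjExponent p := hpq.conjugate_eq
  have e2 : p = Real.conjExponent q := hpq.symm.conjugate_eq
  rw [← e1] at h4
  rw [e2] at h3
  exact ⟨h2, h1, h4, h3⟩

theorem theorem1p1 {E : Type*} [NormedAddCommGroup E] [InnerProductSpace ℝ E] [CompleteSpace E]
    (p : ℝ) :
    (1 < p → p ≤ 2 →
      (∀ (ζ η : E) (Z H : ℝ), (ζ, η, Z, H) ∈ ntvDomain E p →
        ‖η‖ ^ Real.conjExponent p * Z < ‖ζ‖ ^ p * H → ‖ζ‖ ^ p < Z →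
          ∃! s : ℝ × ℝ, IsNTVSolution p ζ η Z H s) ∧
      NTVConditionI p (explicitBellman p : E × E × ℝ × ℝ → ℝ) ∧
      NTVConditionII p (explicitBellman p : E × E × ℝ × ℝ → ℝ)) ∧
    (2 < p →
      NTVConditionI p (fun ((ζ, η, Z, H) : E × E × ℝ × ℝ) =>
        explicitBellman (Real.conjExponent p) (η, ζ, H, Z)) ∧
      NTVConditionII p (fun ((ζ, η, Z, H) : E × E × ℝ × ℝ) =>
        explicitBellman (Real.conjExponent p) (η, ζ, H, Z))) := by
  refine ⟨fun hp hp2 => ⟨fun ζ η Z H ha hreg hZ => ?_, explicitBellman_conditionI hp hp2,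
    explicitBellman_conditionII hp hp2⟩, fun hp => ?_⟩
  · exact (explicitBellman_system hp ha.2.1 hreg hZ).1
  · have hpq : p.HolderConjugate (Real.conjExponent p) :=
      Real.HolderConjugate.conjExponent (by linarith)
    set q := Real.conjExponent p with hq
    have hqp : p = Real.conjExponent q := hpq.symm.conjugate_eq
    have hq1 : 1 < q := hpq.symm.lt
    have hq' : q = p / (p - 1) := hpq.conjugate_eq
    have hq2 : q ≤ 2 := by
      rw [hq', div_le_iff₀ (by linarith)]
      linarith
    refine ⟨fun ζ η Z H ha => ?_, fun ζ₁ η₁ Z₁ H₁ ζ₂ η₂ Z₂ H₂ h₁ h₂ => ?_⟩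
    · have := explicitBellman_conditionI hq1 hq2 η ζ H Z (mem_ntvDomain_swap hpq ha)
      have e1 : q / (q - 1) = p := hqp.symm
      rw [e1, ← hqp, max_comm] at this
      rw [← hq, ← hq']
      refine ⟨this.1, this.2.trans (le_of_eq (by ring))⟩
    · have := explicitBellman_conditionII hq1 hq2 η₁ ζ₁ H₁ Z₁ η₂ ζ₂ H₂ Z₂
        (mem_ntvDomain_swap hpq h₁) (mem_ntvDomain_swap hpq h₂)
      rw [mul_comm]
      exact this
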